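/- Throughout, functions are real-valued and $C^\infty$. For a function $F=F(x,y)$ on an open subset of $\mathbb R^2$ and $n\ge 1$ let $$\Omega_F^n[y]=\Big(\frac{d}{dx}+F(x,y(x))\Big)^n y ,$$ so that $\Omega_F^1[y]=y_x+F(x,y)\,y$ and the coefficient $F(x,y)$ involves the same $y=y(x)$ in every iteration. A \emph{point transformation} on an open set $U\subset\mathbb R^2$ of points $(z,w)$ is a map $x=\rho(z,w)$, $y=\psi(z,w)$ with $\rho_z\psi_w-\rho_w\psi_z\neq 0$ on $U$; let $V$ be the image of $U$. For a subset $S\subset U$, the transformation \emph{takes $\Omega_F^n[y]=0$ to $\Omega_Q^n[w]=0$ on $S$} if, for every curve $w=w(z)$ that is mapped near a point $(z_0,w(z_0))\in S$ to a curve $y=y(x)$, with $\frac{d}{dz}\rho(z,w(z))\ne 0$ at $z_0$, one has $\Omega_F^n[y]=0$ at $x_0=\rho(z_0,w(z_0))$ if and only if $\Omega_Q^n[w]=0$ at $z_0$. A point $p\in U$ is \emph{regular} for $F$ (and $n$) if some such curve through $p$ satisfies $\Omega_F^n[y]=0$ at the corresponding point. The point transformation is an \emph{equivalence transformation of order $n$}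 if for every function $F$ on $V$ there is a function $Q$, defined and smooth at the regular points of $U$ with $w\neq 0$, such that $\Omega_F^n[y]=0$ is taken to $\Omega_Q^n[w]=0$ on the set of these points. \textbf{Theorem 2.} (a) For $n=1$, every point transformation is an equivalence transformation. For each $F$ on $V$, the regular points of $U$ are exactly those where $F(\rho,\psi)\psi\rho_w+\psi_w\neq 0$; on the set of points where in addition $w\ne 0$, the function $$Q_1=\frac{F(\rho,\psi)\,\psi\,\rho_z+\psi_z}{w\,[F(\rho,\psi)\,\psi\,\rho_w+\psi_w]}$$ is smooth and $\Omega_F[y]=0$ is taken to $\Omega_{Q_1}[w]=0$. (b) Let $n\ge 2$ and let $U$ be open, nonempty and connected, with connected slices $\{w:(z,w)\in U\}$ for each $z$. A pair $(\rho,\psi)$ of functions is an equivalence transformation of order $n$ on $U$ if and only if on $U$ $$\rho=\frac{k_2z+k_1}{k_4z+k_3},\qquad \psi=R(z)\,w ,$$ with real constants $k_1,\dots,k_4$ such that $k_4\in\{0,1\}$, $k_2k_3-k_1k_4\neq0$ and $k_4z+k_3\ne 0$ for all $(z,w)\in U$, and a smooth nowhere vanishing function $R$ on the projection of $U$ to the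 $z$-axis. For every such transformation and every $F$ on $V$, the function $$Q_n(z,w)=F(\rho,Rw)\,\rho_z+\frac{R_z}{R}-\frac{n-1}{2}\,\frac{\rho_{zz}}{\rho_z}$$ is smooth on $U$, and $\Omega_F^n[y]=0$ is taken to $\Omega_{Q_n}^n[w]=0$ on all of $U$. -/

import Mathlib

open scoped ContDiff Topology

noncomputable section

namespace RiccatiAbel

/-- The first order operator `d/dx + F(x, y(x))` attached to a parameter function `F` and a
dependent variable `y`, acting on functions `g` of `x`. -/
def op (F : ℝ × ℝ → ℝ) (y g : ℝ → ℝ) : ℝ → ℝ :=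
  fun x => deriv g x + F (x, y x) * g x

/-- `Ω_F^n[y] = (d/dx + F(x,y))^n y`. The coefficient is `F(x, y)` with the same `y` in every
iteration, so that for instance
`Ω_F^2[y] = y'' + (2 F + y F_y) y' + y (F^2 + F_x)`. -/
def Omega (F : ℝ × ℝ → ℝ) (n : ℕ) (y : ℝ → ℝ) : ℝ → ℝ :=
  (op F y)^[n] y

/-- Partial derivative with respect to the first variable `z`. -/
def pdz (f : ℝ × ℝ → ℝ) (p : ℝ × ℝ) : ℝ := fderiv ℝ f p (1, 0)

/-- Partial derivative with respect to the second variable `w`. -/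
def pdw (f : ℝ × ℝ → ℝ) (p : ℝ × ℝ) : ℝ := fderiv ℝ f p (0, 1)

/-- `x = ρ(z,w)`, `y = ψ(z,w)` is a smooth (locally) invertible point transformation on the
open set `U` of the `(z,w)`-plane. -/
structure IsPointTransf (U : Set (ℝ × ℝ)) (ρ ψ : ℝ × ℝ → ℝ) : Prop where
  isOpen : IsOpen U
  smooth_fst : ContDiffOn ℝ ∞ ρ U
  smooth_snd : ContDiffOn ℝ ∞ ψ U
  jacobian_ne_zero : ∀ p ∈ U, pdz ρ p * pdw ψ p - pdw ρ p * pdz ψ p ≠ 0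

/-- The image of `U` in the `(x,y)`-plane. -/
def imageOf (U : Set (ℝ × ℝ)) (ρ ψ : ℝ × ℝ → ℝ) : Set (ℝ × ℝ) :=
  (fun p => (ρ p, ψ p)) '' U

/-- Near the point over `z₀`, the transformation takes the graph of the smooth function `w = w(z)`
to the graph of the smooth function `y = y(x)`. The condition on the derivative of
`z ↦ ρ(z, w(z))` says that `x` can be used as a parameter on the image curve. -/
structure CurveMapsTo (ρ ψ : ℝ × ℝ → ℝ) (w y : ℝ → ℝ) (z₀ : ℝ) : Prop where
  smooth_w : ContDiffAt ℝ ∞ w z₀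
  smooth_y : ContDiffAt ℝ ∞ y (ρ (z₀, w z₀))
  transversal : deriv (fun z => ρ (z, w z)) z₀ ≠ 0
  eventually_eq : ∀ᶠ z in 𝓝 z₀, y (ρ (z, w z)) = ψ (z, w z)

/-- On the set `S` the point transformation turns the equation `Ω_F^n[y] = 0` into the equation
`Ω_Q^n[w] = 0`: along corresponding curves, the first equation holds at a point if and only if
the second one holds at the corresponding point (that is, the two equations correspond to each
other as loci in the space of `n`-jets). -/
def TransformsEq (n : ℕ) (ρ ψ F Q : ℝ × ℝ → ℝ) (S : Set (ℝ × ℝ)) : Prop :=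
  ∀ (w y : ℝ → ℝ) (z₀ : ℝ), CurveMapsTo ρ ψ w y z₀ → (z₀, w z₀) ∈ S →
    (Omega F n y (ρ (z₀, w z₀)) = 0 ↔ Omega Q n w z₀ = 0)

/-- The transformed equation of `Ω_F^n[y] = 0` is satisfied at `p` by some smooth curve
`w = w(z)` through `p`. (For `n ≥ 2` this holds at every point; for `n = 1` it fails
exactly where the transformed equation cannot be solved for `w_z`, its integral curve being
vertical there.) -/
def IsRegularFor (n : ℕ) (ρ ψ F : ℝ × ℝ → ℝ) (p : ℝ × ℝ) : Prop :=
  ∃ w y : ℝ → ℝ, CurveMapsTo ρ ψ w y p.1 ∧ w p.1 = p.2 ∧ Omega F n y (ρ p) = 0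

/-- Equivalence transformations of the family of all equations `Ω_F^n[y] = 0`: point
transformations taking every equation of the family to an equation `Ω_Q^n[w] = 0` of the family.
The new parameter function `Q` may be singular on the line `w = 0` and is
considered only where the transformed equation is satisfied by some curve. -/
def IsEquivTransf (n : ℕ) (U : Set (ℝ × ℝ)) (ρ ψ : ℝ × ℝ → ℝ) : Prop :=
  IsPointTransf U ρ ψ ∧
    ∀ F : ℝ × ℝ → ℝ, ContDiffOn ℝ ∞ F (imageOf U ρ ψ) →
      ∃ Q : ℝ × ℝ → ℝ,
        ContDiffOn ℝ ∞ Q {p | p ∈ U ∧ p.2 ≠ 0 ∧ IsRegularFor n ρ ψ F p} ∧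
        TransformsEq n ρ ψ F Q {p | p ∈ U ∧ p.2 ≠ 0 ∧ IsRegularFor n ρ ψ F p}

/-- The factor `F(ρ,ψ) ψ ρ_w + ψ_w`. -/
def den (ρ ψ F : ℝ × ℝ → ℝ) (p : ℝ × ℝ) : ℝ :=
  F (ρ p, ψ p) * ψ p * pdw ρ p + pdw ψ p

/-- `Q_1 = (F(ρ,ψ) ψ ρ_z + ψ_z) / (w (F(ρ,ψ) ψ ρ_w + ψ_w))`. -/
def Q₁ (ρ ψ F : ℝ × ℝ → ℝ) (p : ℝ × ℝ) : ℝ :=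
  (F (ρ p, ψ p) * ψ p * pdz ρ p + pdz ψ p) / (p.2 * den ρ ψ F p)

/-- The function `z ↦ (k₂ z + k₁) / (k₄ z + k₃)`. -/
def mobius (k₁ k₂ k₃ k₄ : ℝ) (z : ℝ) : ℝ := (k₂ * z + k₁) / (k₄ * z + k₃)

/-- On `U`, the transformation reads `x = (k₂ z + k₁) / (k₄ z + k₃)`, `y = R(z) w`, with `k₄ = 0`
or `k₄ = 1`, a nondegenerate fraction without poles over `U`, and a smooth nowhere vanishing
function `R` on the projection of `U` to the `z`-axis. -/
structure HasMobiusForm (U : Set (ℝ × ℝ)) (ρ ψ : ℝ × ℝ → ℝ) (k₁ k₂ k₃ k₄ : ℝ)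
    (R : ℝ → ℝ) : Prop where
  normalized : k₄ = 0 ∨ k₄ = 1
  nondegenerate : k₂ * k₃ - k₁ * k₄ ≠ 0
  no_pole : ∀ p ∈ U, k₄ * p.1 + k₃ ≠ 0
  smooth_R : ContDiffOn ℝ ∞ R (Prod.fst '' U)
  R_ne_zero : ∀ p ∈ U, R p.1 ≠ 0
  fst_eq : ∀ p ∈ U, ρ p = mobius k₁ k₂ k₃ k₄ p.1
  snd_eq : ∀ p ∈ U, ψ p = R p.1 * p.2

/-- `Q_n = F(m, R w) m_z + R_z / R - ((n - 1) / 2) m_zz / m_z` for functions `m`, `R` of `z`. -/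
def Qₙ (n : ℕ) (F : ℝ × ℝ → ℝ) (m R : ℝ → ℝ) (p : ℝ × ℝ) : ℝ :=
  F (m p.1, R p.1 * p.2) * deriv m p.1 + deriv R p.1 / R p.1
    - (((n : ℝ) - 1) / 2) * (deriv (deriv m) p.1 / deriv m p.1)

end RiccatiAbel

end

open RiccatiAbel

noncomputable section

namespace RiccatiAbel

open Filter

/-! Order one is the chain rule. With `T = ρ_z + ρ_w w'`, along corresponding curves `T * Ω_F[y] =
den * w' + num`, where `num` is the numerator of `Q₁`, and `ρ_z * den - ρ_w * num` is the Jacobian.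
So the equation can be solved transversally exactly where `den ≠ 0`.

For `n ≥ 2`, sufficiency rests on Bol's lemma (`bol`). If `ρ = m(z)` is Moebius with denominator
`t`, then `1 / m'` is a constant times `t²`, and `(t² D)^n = t^(n+1) D^n t^(n-1)` for `D = d/dz +
G`. Conjugating by `t^(n-1) R` turns `D` into `d/dz + Q_n` (`HasMobiusForm.mul_Omega_eq`).

For necessity, both `Ω` are affine in the derivative of order `n`, so equal zero loci force `T^(n+1)
Ω_F[y] = J Ω_Q[w]`, with `J` the Jacobian (`TransformsEq.mul_Omega_eq`). Test functions `F` and test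
curves are then inserted. - `F = 0` and `F = (x - x₀)^(n-1)`, on lines of slope `s`: the left sides
differ by a constant times `T^(n+1)`, the right sides by a polynomial of degree at most `n - 1` in
`s`. Hence `ρ_w = 0` and `ρ = m(z)`. - `F = c`, coefficient of `w^(n-1)`: its dependence on the
slope gives `ψ_ww = 0`, so `ψ = R w + S`. What remains is an Euler equation, with solution `Q = q(z)
+ κ(z) w^(-n)`. - `F = c`, on the curves `w = const`: comparing powers of `1 / w` gives `κ = 0` and
`(d/dx + c)^n S = 0`, with `S` read as a function of `x`. The latter holds for every `c`, and `S` is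
its leading coefficient in `c`, so `S = 0`. - `F = 0`, on the solutions `const + t (x - x₀)^(n-2)`:
with `Q = q` known, the derivative of order `n` of `|m'|^(-(n-1)/2) (m - x₀)^(n-2)` vanishes at the
base point. It is a nonzero multiple of the Schwarzian of `m`, so `m` is Moebius. Each identity is
proved for `w ≠ 0` and extends to `w = 0` by continuity. -/

theorem smoothAt_deriv {f : ℝ → ℝ} {z : ℝ} (hf : ContDiffAt ℝ ∞ f z) :
    ContDiffAt ℝ ∞ (deriv f) z := by
  have h : ContDiffAt ℝ ∞ (fderiv ℝ f) z := hf.fderiv_right (by simp)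
  exact h.clm_apply contDiffAt_const

theorem differentiableAt_eventually {E : Type*} [NormedAddCommGroup E] [NormedSpace ℝ E]
    {f : E → ℝ} {z : E} (hf : ContDiffAt ℝ ∞ f z) :
    ∀ᶠ x in 𝓝 z, DifferentiableAt ℝ f x := by
  have h : ContDiffAt ℝ 1 f z := hf.of_le (by exact_mod_cast le_top)
  filter_upwards [h.eventually (by simp)] with x hx using hx.differentiableAt (by simp)

theorem differentiableAt_of_smoothAt {E : Type*} [NormedAddCommGroup E] [NormedSpace ℝ E]
    {f : E → ℝ} {z : E} (hf : ContDiffAt ℝ ∞ f z) : DifferentiableAt ℝ f z :=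
  hf.differentiableAt (by simp)

theorem deriv_add_eventuallyEq {f g : ℝ → ℝ} {z : ℝ} (hf : ContDiffAt ℝ ∞ f z)
    (hg : ContDiffAt ℝ ∞ g z) : deriv (f + g) =ᶠ[𝓝 z] deriv f + deriv g := by
  filter_upwards [differentiableAt_eventually hf, differentiableAt_eventually hg] with x h1 h2
  simp [deriv_add h1 h2]

theorem deriv_mul_eventuallyEq {f g : ℝ → ℝ} {z : ℝ} (hf : ContDiffAt ℝ ∞ f z)
    (hg : ContDiffAt ℝ ∞ g z) : deriv (f * g) =ᶠ[𝓝 z] deriv f * g + f * deriv g := by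
  filter_upwards [differentiableAt_eventually hf, differentiableAt_eventually hg] with x h1 h2
  simp [deriv_mul h1 h2]

theorem deriv_comp_eventuallyEq {f m : ℝ → ℝ} {z : ℝ} (hf : ContDiffAt ℝ ∞ f (m z))
    (hm : ContDiffAt ℝ ∞ m z) : deriv (f ∘ m) =ᶠ[𝓝 z] (deriv f ∘ m) * deriv m := by
  filter_upwards [hm.continuousAt.eventually (differentiableAt_eventually hf),
    differentiableAt_eventually hm] with x h1 h2
  simp [deriv_comp x h1 h2]

/-! ### Iterates of `d/dx + q` on germs of smooth functions -/

/-- The operator `d/dx + q(x)`. -/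
def opc (q g : ℝ → ℝ) : ℝ → ℝ := deriv g + q * g

theorem opc_apply (q g : ℝ → ℝ) (x : ℝ) : opc q g x = deriv g x + q x * g x := rfl

theorem opc_zero (g : ℝ → ℝ) : opc 0 g = deriv g := by simp [opc]

theorem Omega_eq_iterate (F : ℝ × ℝ → ℝ) (n : ℕ) (y : ℝ → ℝ) :
    Omega F n y = (opc fun x => F (x, y x))^[n] y := rfl

theorem smoothAt_opc {q g : ℝ → ℝ} {z : ℝ} (hq : ContDiffAt ℝ ∞ q z)
    (hg : ContDiffAt ℝ ∞ g z) : ContDiffAt ℝ ∞ (opc q g) z :=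
  (smoothAt_deriv hg).add (hq.mul hg)

theorem smoothAt_iterate_opc {q : ℝ → ℝ} {z : ℝ} (hq : ContDiffAt ℝ ∞ q z) (n : ℕ) :
    ∀ {g : ℝ → ℝ}, ContDiffAt ℝ ∞ g z → ContDiffAt ℝ ∞ ((opc q)^[n] g) z := by
  induction n with
  | zero => intro g hg; exact hg
  | succ n ih => intro g hg; exact ih (smoothAt_opc hq hg)

theorem opc_congr {q q' g g' : ℝ → ℝ} {z : ℝ} (hq : q =ᶠ[𝓝 z] q') (hg : g =ᶠ[𝓝 z] g') :
    opc q g =ᶠ[𝓝 z] opc q' g' :=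
  hg.deriv.add (hq.mul hg)

theorem iterate_opc_congr {q q' : ℝ → ℝ} {z : ℝ} (hq : q =ᶠ[𝓝 z] q') (n : ℕ) :
    ∀ {g g' : ℝ → ℝ}, g =ᶠ[𝓝 z] g' → (opc q)^[n] g =ᶠ[𝓝 z] (opc q')^[n] g' := by
  induction n with
  | zero => intro g g' hg; exact hg
  | succ n ih => intro g g' hg; exact ih (opc_congr hq hg)

theorem opc_add {q f g : ℝ → ℝ} {z : ℝ} (hf : ContDiffAt ℝ ∞ f z) (hg : ContDiffAt ℝ ∞ g z) :
    opc q (f + g) =ᶠ[𝓝 z] opc q f + opc q g := by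
  filter_upwards [deriv_add_eventuallyEq hf hg] with x hx
  simp only [opc, Pi.add_apply, Pi.mul_apply] at hx ⊢
  rw [hx]; ring

theorem iterate_opc_add {q : ℝ → ℝ} {z : ℝ} (hq : ContDiffAt ℝ ∞ q z) (n : ℕ) :
    ∀ {f g : ℝ → ℝ}, ContDiffAt ℝ ∞ f z → ContDiffAt ℝ ∞ g z →
      (opc q)^[n] (f + g) =ᶠ[𝓝 z] (opc q)^[n] f + (opc q)^[n] g := by
  induction n with
  | zero => intro f g _ _; exact EventuallyEq.rfl
  | succ n ih =>
    intro f g hf hg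
    exact (iterate_opc_congr EventuallyEq.rfl n (opc_add hf hg)).trans
      (ih (smoothAt_opc hq hf) (smoothAt_opc hq hg))

theorem opc_smul (q g : ℝ → ℝ) (c : ℝ) : opc q (c • g) = c • opc q g := by
  funext x
  simp only [opc, Pi.add_apply, Pi.mul_apply, Pi.smul_apply, smul_eq_mul]
  rw [deriv_const_smul_field]
  simp only [smul_eq_mul]; ring

theorem iterate_opc_smul (q : ℝ → ℝ) (c : ℝ) (n : ℕ) :
    ∀ g : ℝ → ℝ, (opc q)^[n] (c • g) = c • (opc q)^[n] g := by
  induction n with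
  | zero => intro g; rfl
  | succ n ih => intro g; simp only [Function.iterate_succ_apply, opc_smul, ih]

/-! ### Calculus of the two leading derivatives of a germ -/

/-- `f` has vanishing derivatives of order less than `k` at `z`, and its derivatives of order `k`
and `k + 1` are `a` and `b`. -/
def Lead (z : ℝ) : ℕ → ℝ → ℝ → (ℝ → ℝ) → Prop
  | 0, a, b, f => f z = a ∧ deriv f z = b
  | k + 1, a, b, f => f z = 0 ∧ Lead z k a b (deriv f)

namespace Lead

variable {z : ℝ} {k : ℕ} {a b a' b' : ℝ} {f g : ℝ → ℝ}

theorem congr (h : Lead z k a b f) (hfg : f =ᶠ[𝓝 z] g) : Lead z k a b g := by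
  induction k generalizing f g with
  | zero => exact ⟨hfg.eq_of_nhds ▸ h.1, hfg.deriv_eq ▸ h.2⟩
  | succ k ih => exact ⟨hfg.eq_of_nhds ▸ h.1, ih h.2 hfg.deriv⟩

theorem unique (h : Lead z k a b f) (h' : Lead z k a' b' f) : a = a' ∧ b = b' := by
  induction k generalizing f with
  | zero => exact ⟨h.1.symm.trans h'.1, h.2.symm.trans h'.2⟩
  | succ k ih => exact ih h.2 h'.2

theorem cast (h : Lead z k a b f) (ha : a = a') (hb : b = b') : Lead z k a' b' f := ha ▸ hb ▸ h

theorem lower (h : Lead z (k + 1) a b f) : Lead z k 0 a f := by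
  induction k generalizing f with
  | zero => exact ⟨h.1, h.2.1⟩
  | succ k ih => exact ⟨h.1, ih h.2⟩

theorem add (h : Lead z k a b f) (h' : Lead z k a' b' g) (hf : ContDiffAt ℝ ∞ f z)
    (hg : ContDiffAt ℝ ∞ g z) : Lead z k (a + a') (b + b') (f + g) := by
  induction k generalizing f g with
  | zero =>
    refine ⟨by simp [h.1, h'.1], ?_⟩
    rw [(deriv_add_eventuallyEq hf hg).eq_of_nhds]
    simp [h.2, h'.2]
  | succ k ih =>
    exact ⟨by simp [h.1, h'.1], (ih h.2 h'.2 (smoothAt_deriv hf) (smoothAt_deriv hg)).congr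
      (deriv_add_eventuallyEq hf hg).symm⟩

theorem mul (h : Lead z k a b f) (hf : ContDiffAt ℝ ∞ f z) (hg : ContDiffAt ℝ ∞ g z) :
    Lead z k (a * g z) (b * g z + (k + 1) * a * deriv g z) (f * g) := by
  induction k generalizing f g a b with
  | zero =>
    refine ⟨by simp [h.1], ?_⟩
    rw [(deriv_mul_eventuallyEq hf hg).eq_of_nhds]
    simp [h.1, h.2]
  | succ k ih =>
    refine ⟨by simp [h.1], Lead.congr (Lead.cast (Lead.add (ih h.2 (smoothAt_deriv hf) hg)
      (ih h.lower hf (smoothAt_deriv hg)) ?_ ?_) ?_ ?_) (deriv_mul_eventuallyEq hf hg).symm⟩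
    · exact (smoothAt_deriv hf).mul hg
    · exact hf.mul (smoothAt_deriv hg)
    · simp
    · push_cast; ring

theorem neg (h : Lead z k a b f) : Lead z k (-a) (-b) (-f) := by
  induction k generalizing f with
  | zero => exact ⟨by simp [h.1], by rw [deriv.neg']; simp [h.2]⟩
  | succ k ih => exact ⟨by simp [h.1], by rw [deriv.neg']; exact ih h.2⟩

theorem sub (h : Lead z k a b f) (h' : Lead z k a' b' g) (hf : ContDiffAt ℝ ∞ f z)
    (hg : ContDiffAt ℝ ∞ g z) : Lead z k (a - a') (b - b') (f - g) := by
  rw [sub_eq_add_neg f g, sub_eq_add_neg a, sub_eq_add_neg b]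
  exact h.add h'.neg hf hg.neg

theorem zero (z : ℝ) (k : ℕ) : Lead z k 0 0 (0 : ℝ → ℝ) := by
  induction k with
  | zero => exact ⟨rfl, by rw [deriv_zero]; rfl⟩
  | succ k ih => exact ⟨rfl, by rw [deriv_zero]; exact ih⟩

/-- Faà di Bruno with only two surviving terms. For `k = n - 1` the factor `k (k + 1) / 2` is `n (n
- 1) / 2`; after division by `n` it is the source of the term `(n - 1) / 2 * m'' / m'` in `Qₙ`. -/
theorem comp {m : ℝ → ℝ} (h : Lead (m z) k a b f) (hf : ContDiffAt ℝ ∞ f (m z))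
    (hm : ContDiffAt ℝ ∞ m z) (hm0 : deriv m z ≠ 0) :
    Lead z k (a * deriv m z ^ k) (b * deriv m z ^ (k + 1) + (k * (k + 1) / 2) *
      deriv m z ^ k * (deriv (deriv m) z / deriv m z) * a) (f ∘ m) := by
  induction k generalizing f with
  | zero =>
    refine ⟨by simp [h.1], ?_⟩
    rw [(deriv_comp_eventuallyEq hf hm).eq_of_nhds]
    simp [h.2]
  | succ k ih =>
    refine ⟨by simp [h.1], (((ih h.2 (smoothAt_deriv hf)).mul ((smoothAt_deriv hf).comp z hm)
      (smoothAt_deriv hm)).cast ?_ ?_).congr (deriv_comp_eventuallyEq hf hm).symm⟩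
    · ring
    · push_cast; field_simp; ring

/-- The order of vanishing survives a change of parameter: dividing `(f ∘ m)' = (f' ∘ m) m'` by `m'`
allows induction. The actual values of `a'` and `b'` are recovered later from `comp` and `unique`.
-/
theorem exists_of_comp {m : ℝ → ℝ} (h : Lead z k a b (f ∘ m)) (hf : ContDiffAt ℝ ∞ f (m z))
    (hm : ContDiffAt ℝ ∞ m z) (hm0 : deriv m z ≠ 0) : ∃ a' b', Lead (m z) k a' b' f := by
  induction k generalizing f a b with
  | zero => exact ⟨_, _, rfl, rfl⟩
  | succ k ih =>
    have h1 := h.2.congr (deriv_comp_eventuallyEq hf hm)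
    have hi : ContDiffAt ℝ ∞ (deriv m)⁻¹ z := (smoothAt_deriv hm).inv hm0
    have hs := ((smoothAt_deriv hf).comp z hm)
    have h2 := (h1.mul (hs.mul (smoothAt_deriv hm)) hi).congr (g := deriv f ∘ m) (by
      filter_upwards [(smoothAt_deriv hm).continuousAt.eventually_ne hm0] with x hx
      simp [hx])
    obtain ⟨a', b', h'⟩ := ih h2 (smoothAt_deriv hf)
    exact ⟨a', b', h.1, h'⟩

end Lead

/-! ### Monomial perturbations and the first variation of `(d/dx + q)^n` -/

theorem deriv_const_mul_sub_pow (c z : ℝ) (n : ℕ) :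
    deriv (fun x => c * (x - z) ^ (n + 1)) = fun x => (c * (n + 1)) * (x - z) ^ n := by
  funext x
  simp [mul_assoc]

theorem lead_pow (z c : ℝ) (n : ℕ) :
    Lead z n (c * n.factorial) 0 (fun x => c * (x - z) ^ n) := by
  induction n generalizing c with
  | zero => exact ⟨by simp, by simp⟩
  | succ n ih =>
    refine ⟨by simp, ?_⟩
    rw [deriv_const_mul_sub_pow]
    exact (ih (c * (n + 1))).cast (by push_cast [Nat.factorial_succ]; ring) rfl

theorem opc_add_sub {q η g e : ℝ → ℝ} {z : ℝ} (hg : ContDiffAt ℝ ∞ g z)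
    (he : ContDiffAt ℝ ∞ e z) :
    opc (q + η) (g + e) =ᶠ[𝓝 z] opc q g + (deriv e + e * (q + η) + η * g) := by
  filter_upwards [deriv_add_eventuallyEq hg he] with x hx
  simp only [opc, Pi.add_apply, Pi.mul_apply] at hx ⊢
  rw [hx]; ring

/-- Here `η` vanishes to one order more than in the sharp version relative to the number of
applications, so it leaves no trace; each application adds one `q z * μ` to the second leading
derivative of the error. -/
theorem iterate_opc_add_sub_aux {q η : ℝ → ℝ} {z : ℝ} (hq : ContDiffAt ℝ ∞ q z)
    (hη : ContDiffAt ℝ ∞ η z) (k : ℕ) :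
    ∀ {g e : ℝ → ℝ} {b b' μ ν : ℝ}, ContDiffAt ℝ ∞ g z → ContDiffAt ℝ ∞ e z →
      Lead z (k + 1) b b' η → Lead z k μ ν e →
      (opc (q + η))^[k + 1] (g + e) z - (opc q)^[k + 1] g z = ν + (k + 1) * q z * μ := by
  induction k with
  | zero =>
    intro g e b b' μ ν hg he h1 h2
    have := (opc_add_sub (q := q) (η := η) hg he).eq_of_nhds
    simp only [Function.iterate_succ_apply, Function.iterate_zero, id]
    rw [this]
    simp [h1.1, h2.1, h2.2]; ring
  | succ k ih =>
    intro g e b b' μ ν hg he h1 h2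
    have hs : ContDiffAt ℝ ∞ (deriv e + e * (q + η) + η * g) z :=
      ((smoothAt_deriv he).add (he.mul (hq.add hη))).add (hη.mul hg)
    have h3 : Lead z k μ (ν + q z * μ) (deriv e + e * (q + η) + η * g) := by
      refine Lead.cast (Lead.add (Lead.add h2.2 (h2.lower.mul he (hq.add hη)) ?_ ?_)
        (h1.lower.lower.mul hη hg) ?_ ?_) ?_ ?_
      · exact smoothAt_deriv he
      · exact he.mul (hq.add hη)
      · exact (smoothAt_deriv he).add (he.mul (hq.add hη))
      · exact hη.mul hg
      · simp
      · simp [h1.1]; ring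
    rw [Function.iterate_succ_apply, Function.iterate_succ_apply (opc q),
      (iterate_opc_congr EventuallyEq.rfl (k + 1) (opc_add_sub hg he)).eq_of_nhds,
      ih (smoothAt_opc hq hg) hs h1.lower h3]
    push_cast; ring

/-- First variation of `(d/dx + q)^n g` under a change of `q` and `g` that vanishes to order
`n - 1`. -/
theorem iterate_opc_add_sub {q η g e : ℝ → ℝ} {z b b' μ ν : ℝ} {k : ℕ}
    (hq : ContDiffAt ℝ ∞ q z) (hη : ContDiffAt ℝ ∞ η z) (hg : ContDiffAt ℝ ∞ g z)
    (he : ContDiffAt ℝ ∞ e z) (h1 : Lead z (k + 1) b b' η) (h2 : Lead z (k + 1) μ ν e) :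
    (opc (q + η))^[k + 2] (g + e) z - (opc q)^[k + 2] g z = ν + (k + 2) * q z * μ + g z * b := by
  have hs : ContDiffAt ℝ ∞ (deriv e + e * (q + η) + η * g) z :=
    ((smoothAt_deriv he).add (he.mul (hq.add hη))).add (hη.mul hg)
  -- Only the first application sees `η` undiminished: its term `η * g` still undergoes `k + 1`
  -- differentiations and yields `g z * b`.
  have h3 : Lead z k μ (ν + q z * μ + g z * b) (deriv e + e * (q + η) + η * g) := by
    refine Lead.cast (Lead.add (Lead.add h2.2 (h2.lower.mul he (hq.add hη)) ?_ ?_)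
      (h1.lower.mul hη hg) ?_ ?_) ?_ ?_
    · exact smoothAt_deriv he
    · exact he.mul (hq.add hη)
    · exact (smoothAt_deriv he).add (he.mul (hq.add hη))
    · exact hη.mul hg
    · simp
    · simp [h1.1]; ring
  rw [Function.iterate_succ_apply, Function.iterate_succ_apply (opc q),
    (iterate_opc_congr EventuallyEq.rfl (k + 1) (opc_add_sub hg he)).eq_of_nhds,
    iterate_opc_add_sub_aux hq hη k (smoothAt_opc hq hg) hs h1 h3]
  ring

/-! ### Functions of two variables along curves, and their increments -/

theorem smoothAt_pdz {f : ℝ × ℝ → ℝ} {p : ℝ × ℝ} (hf : ContDiffAt ℝ ∞ f p) :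
    ContDiffAt ℝ ∞ (pdz f) p := by
  have h : ContDiffAt ℝ ∞ (fderiv ℝ f) p := hf.fderiv_right (by simp)
  exact h.clm_apply contDiffAt_const

theorem smoothAt_pdw {f : ℝ × ℝ → ℝ} {p : ℝ × ℝ} (hf : ContDiffAt ℝ ∞ f p) :
    ContDiffAt ℝ ∞ (pdw f) p := by
  have h : ContDiffAt ℝ ∞ (fderiv ℝ f) p := hf.fderiv_right (by simp)
  exact h.clm_apply contDiffAt_const

theorem fderiv_apply_eq (f : ℝ × ℝ → ℝ) (p : ℝ × ℝ) (a b : ℝ) :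
    fderiv ℝ f p (a, b) = a * pdz f p + b * pdw f p := by
  have : ((a, b) : ℝ × ℝ) = a • (1, 0) + b • (0, 1) := by simp
  rw [this, map_add, map_smul, map_smul]; rfl

theorem smoothAt_curve {f : ℝ × ℝ → ℝ} {w : ℝ → ℝ} {z : ℝ} (hf : ContDiffAt ℝ ∞ f (z, w z))
    (hw : ContDiffAt ℝ ∞ w z) : ContDiffAt ℝ ∞ (fun x => f (x, w x)) z :=
  ContDiffAt.comp z (f := fun x => (x, w x)) hf (contDiffAt_id.prodMk hw)

theorem deriv_curve {f : ℝ × ℝ → ℝ} {w : ℝ → ℝ} {z : ℝ} (hf : DifferentiableAt ℝ f (z, w z))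
    (hw : DifferentiableAt ℝ w z) :
    deriv (fun x => f (x, w x)) z = pdz f (z, w z) + pdw f (z, w z) * deriv w z := by
  have h1 : HasDerivAt (fun x => (x, w x)) (1, deriv w z) z :=
    (hasDerivAt_id z).prodMk hw.hasDerivAt
  have h2 := hf.hasFDerivAt.comp_hasDerivAt_of_eq z h1 rfl
  have h3 := h2.deriv
  rw [fderiv_apply_eq] at h3
  rw [show (fun x => f (x, w x)) = f ∘ fun x => (x, w x) from rfl, h3]; ring

theorem deriv_curve_eventuallyEq {f : ℝ × ℝ → ℝ} {w : ℝ → ℝ} {z : ℝ}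
    (hf : ContDiffAt ℝ ∞ f (z, w z)) (hw : ContDiffAt ℝ ∞ w z) :
    deriv (fun x => f (x, w x)) =ᶠ[𝓝 z]
      (fun x => pdz f (x, w x)) + (fun x => pdw f (x, w x)) * deriv w := by
  have hc : ContinuousAt (fun x => (x, w x)) z := continuousAt_id.prodMk hw.continuousAt
  filter_upwards [hc.eventually (differentiableAt_eventually hf),
    differentiableAt_eventually hw] with x h1 h2
  rw [deriv_curve h1 h2]; rfl

/-- Increment of `f` along the curve `w` when `w` is replaced by `w + δ`. -/
def incr (f : ℝ × ℝ → ℝ) (w δ : ℝ → ℝ) : ℝ → ℝ :=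
  (fun x => f (x, w x + δ x)) - fun x => f (x, w x)

theorem smoothAt_incr {f : ℝ × ℝ → ℝ} {w δ : ℝ → ℝ} {z : ℝ} (hf : ContDiffAt ℝ ∞ f (z, w z))
    (hw : ContDiffAt ℝ ∞ w z) (hδ : ContDiffAt ℝ ∞ δ z) (h0 : δ z = 0) :
    ContDiffAt ℝ ∞ (incr f w δ) z := by
  refine ContDiffAt.sub ?_ (smoothAt_curve hf hw)
  exact smoothAt_curve (w := fun x => w x + δ x) (by simpa [h0] using hf) (hw.add hδ)

theorem deriv_incr {f : ℝ × ℝ → ℝ} {w δ : ℝ → ℝ} {z : ℝ} (hf : ContDiffAt ℝ ∞ f (z, w z))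
    (hw : ContDiffAt ℝ ∞ w z) (hδ : ContDiffAt ℝ ∞ δ z) (h0 : δ z = 0) :
    deriv (incr f w δ) =ᶠ[𝓝 z] incr (pdz f) w δ + incr (pdw f) w δ * deriv w +
      deriv δ * fun x => pdw f (x, w x + δ x) := by
  have hf' : ContDiffAt ℝ ∞ f (z, w z + δ z) := by simpa [h0] using hf
  have hs : ContDiffAt ℝ ∞ (fun x => w x + δ x) z := hw.add hδ
  filter_upwards [deriv_curve_eventuallyEq hf hw,
    deriv_curve_eventuallyEq (w := fun x => w x + δ x) hf' hs,
    differentiableAt_eventually (smoothAt_curve hf hw),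
    differentiableAt_eventually (smoothAt_curve (w := fun x => w x + δ x) hf' hs),
    differentiableAt_eventually hw, differentiableAt_eventually hδ] with x h1 h2 h3 h4 h5 h6
  rw [incr, deriv_sub h4 h3, h1, h2]
  simp only [Pi.add_apply, Pi.mul_apply, deriv_fun_add h5 h6, incr, Pi.sub_apply]
  ring

/-- Taylor expansion in `δ`: the linear term `f_w δ` gives everything except the case `k = 0`, where
`δ²` vanishes only to order two and `f_ww δ² / 2` reaches the second derivative. The induction
differentiates the increment, which brings in those of `f_z` and `f_w`; the two mixed partials stay
separate, so their symmetry is not invoked. -/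
theorem lead_incr {w δ : ℝ → ℝ} {z : ℝ} (hw : ContDiffAt ℝ ∞ w z)
    (hδ : ContDiffAt ℝ ∞ δ z) (k : ℕ) : ∀ {f : ℝ × ℝ → ℝ} {a b : ℝ},
    ContDiffAt ℝ ∞ f (z, w z) → Lead z (k + 1) a b δ →
    Lead z (k + 1) (pdw f (z, w z) * a)
      (pdw f (z, w z) * b
        + (pdw (pdz f) (z, w z) + pdw (pdw f) (z, w z) * deriv w z) * a
        + (k + 1) * (pdz (pdw f) (z, w z) + pdw (pdw f) (z, w z) * deriv w z) * a
        + if k = 0 then pdw (pdw f) (z, w z) * a ^ 2 else 0) (incr f w δ) := by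
  have key : ∀ f : ℝ × ℝ → ℝ, ContDiffAt ℝ ∞ f (z, w z) → δ z = 0 →
      ContDiffAt ℝ ∞ (fun x => pdw f (x, w x + δ x)) z := by
    intro f hf h0
    refine smoothAt_curve (w := fun x => w x + δ x) ?_ (hw.add hδ)
    simpa [h0] using smoothAt_pdw hf
  have key2 : ∀ f : ℝ × ℝ → ℝ, ContDiffAt ℝ ∞ f (z, w z) → δ z = 0 →
      deriv (fun x => f (x, w x + δ x)) z
        = pdz f (z, w z) + pdw f (z, w z) * (deriv w z + deriv δ z) := by
    intro f hf h0
    rw [deriv_curve (w := fun x => w x + δ x), deriv_fun_add (differentiableAt_of_smoothAt hw)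
      (differentiableAt_of_smoothAt hδ)]
    · simp [h0]
    · simpa [h0] using differentiableAt_of_smoothAt hf
    · exact differentiableAt_of_smoothAt (hw.add hδ)
  have key1 : ∀ f : ℝ × ℝ → ℝ, ContDiffAt ℝ ∞ f (z, w z) → δ z = 0 →
      Lead z 0 0 (pdw f (z, w z) * deriv δ z) (incr f w δ) := by
    intro f hf h0
    refine ⟨by simp [incr, h0], ?_⟩
    rw [(deriv_incr hf hw hδ h0).eq_of_nhds]
    simp [incr, h0]; ring
  induction k with
  | zero =>
    intro f a b hf h
    obtain ⟨h0, h1, h2⟩ := h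
    refine ⟨by simp [incr, h0], ?_⟩
    have e1 := key1 _ (smoothAt_pdz hf) h0
    have e2 := key1 _ (smoothAt_pdw hf) h0
    have s1 := smoothAt_incr (smoothAt_pdz hf) hw hδ h0
    have s2 := smoothAt_incr (smoothAt_pdw hf) hw hδ h0
    have e3 := Lead.mul (k := 0) ⟨h1, h2⟩ (smoothAt_deriv hδ) (key f hf h0)
    have e4 := (e1.add (e2.mul s2 (smoothAt_deriv hw)) s1 (s2.mul (smoothAt_deriv hw))).add e3
      (s1.add (s2.mul (smoothAt_deriv hw))) ((smoothAt_deriv hδ).mul (key f hf h0))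
    refine (e4.cast ?_ ?_).congr (deriv_incr hf hw hδ h0).symm
    · simp [h0]; ring
    · rw [key2 _ (smoothAt_pdw hf) h0]
      simp [h0, h1]; ring
  | succ k ih =>
    intro f a b hf h
    have h0 := h.1
    have h1 : deriv δ z = 0 := h.2.1
    refine ⟨by simp [incr, h0], ?_⟩
    have e1 := ih (smoothAt_pdz hf) h.lower
    have e2 := ih (smoothAt_pdw hf) h.lower
    have s1 := smoothAt_incr (smoothAt_pdz hf) hw hδ h0
    have s2 := smoothAt_incr (smoothAt_pdw hf) hw hδ h0
    have e3 := h.2.mul (smoothAt_deriv hδ) (key f hf h0)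
    have e4 := (e1.add (e2.mul s2 (smoothAt_deriv hw)) s1 (s2.mul (smoothAt_deriv hw))).add e3
      (s1.add (s2.mul (smoothAt_deriv hw))) ((smoothAt_deriv hδ).mul (key f hf h0))
    refine (e4.cast ?_ ?_).congr (deriv_incr hf hw hδ h0).symm
    · simp [h0]; ring
    · rw [key2 _ (smoothAt_pdw hf) h0]
      simp [h0, h1]; ring

/-- A function with nonzero derivative has a smooth local inverse. -/
theorem exists_comp_eventuallyEq {X Y : ℝ → ℝ} {z : ℝ} (hX : ContDiffAt ℝ ∞ X z)
    (hX0 : deriv X z ≠ 0) (hY : ContDiffAt ℝ ∞ Y z) :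
    ∃ y : ℝ → ℝ, ContDiffAt ℝ ∞ y (X z) ∧ y ∘ X =ᶠ[𝓝 z] Y := by
  have hd : HasFDerivAt X (ContinuousLinearEquiv.unitsEquivAut ℝ (Units.mk0 _ hX0) : ℝ →L[ℝ] ℝ)
      z := by
    have := (differentiableAt_of_smoothAt hX).hasDerivAt.hasFDerivAt
    have e : (ContinuousLinearEquiv.unitsEquivAut ℝ (Units.mk0 _ hX0) : ℝ →L[ℝ] ℝ)
        = ContinuousLinearMap.toSpanSingleton ℝ (deriv X z) := by ext; simp
    rw [e]; exact this
  have hn : (∞ : WithTop ℕ∞) ≠ 0 := by simp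
  refine ⟨Y ∘ hX.localInverse hd hn, ?_, ?_⟩
  · have h1 := hX.to_localInverse hd hn
    refine ContDiffAt.comp _ ?_ h1
    rwa [hX.localInverse_apply_image hd hn]
  · have := (hX.hasStrictFDerivAt' hd hn).eventually_left_inverse
    filter_upwards [this] with x hx
    change Y (hX.localInverse hd hn (X x)) = Y x
    exact congrArg Y hx

/-! ### Corresponding curves and proportionality of the two equations -/

section Curves

variable {ρ ψ : ℝ × ℝ → ℝ} {w y : ℝ → ℝ} {z : ℝ}

/-- The Jacobian determinant of `(ρ, ψ)`. -/
def jac (ρ ψ : ℝ × ℝ → ℝ) (p : ℝ × ℝ) : ℝ := pdz ρ p * pdw ψ p - pdw ρ p * pdz ψ p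

theorem exists_curveMapsTo (hρ : ContDiffAt ℝ ∞ ρ (z, w z)) (hψ : ContDiffAt ℝ ∞ ψ (z, w z))
    (hw : ContDiffAt ℝ ∞ w z) (ht : pdz ρ (z, w z) + pdw ρ (z, w z) * deriv w z ≠ 0) :
    ∃ y, CurveMapsTo ρ ψ w y z := by
  have hd : deriv (fun x => ρ (x, w x)) z ≠ 0 := by
    rwa [deriv_curve (differentiableAt_of_smoothAt hρ) (differentiableAt_of_smoothAt hw)]
  obtain ⟨y, hy, he⟩ := exists_comp_eventuallyEq (smoothAt_curve hρ hw) hd (smoothAt_curve hψ hw)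
  exact ⟨y, hw, hy, hd, he⟩

theorem transversal_eq (hρ : ContDiffAt ℝ ∞ ρ (z, w z)) (h : CurveMapsTo ρ ψ w y z) :
    pdz ρ (z, w z) + pdw ρ (z, w z) * deriv w z ≠ 0 := by
  have := h.transversal
  rwa [deriv_curve (differentiableAt_of_smoothAt hρ)
    (differentiableAt_of_smoothAt h.smooth_w)] at this

theorem deriv_image (hρ : ContDiffAt ℝ ∞ ρ (z, w z)) (hψ : ContDiffAt ℝ ∞ ψ (z, w z))
    (h : CurveMapsTo ρ ψ w y z) :
    deriv y (ρ (z, w z)) * (pdz ρ (z, w z) + pdw ρ (z, w z) * deriv w z)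
      = pdz ψ (z, w z) + pdw ψ (z, w z) * deriv w z := by
  have hw := h.smooth_w
  have e : (y ∘ fun x => ρ (x, w x)) =ᶠ[𝓝 z] fun x => ψ (x, w x) := h.eventually_eq
  have e' := e.deriv_eq
  rw [(deriv_comp_eventuallyEq (m := fun x => ρ (x, w x)) h.smooth_y
    (smoothAt_curve hρ hw)).eq_of_nhds,
    deriv_curve (differentiableAt_of_smoothAt hψ) (differentiableAt_of_smoothAt hw)] at e'
  rw [← e', Pi.mul_apply, deriv_curve (differentiableAt_of_smoothAt hρ)
    (differentiableAt_of_smoothAt hw)]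
  rfl

theorem pdw_comp_snd {y : ℝ → ℝ} {p : ℝ × ℝ} (hy : DifferentiableAt ℝ y p.2) :
    pdw (fun q => y q.2) p = deriv y p.2 := by
  have h1 : HasFDerivAt (fun q : ℝ × ℝ => y q.2) _ p :=
    hy.hasDerivAt.hasFDerivAt.comp p hasFDerivAt_snd
  rw [pdw, h1.fderiv]; simp

/-- If two curves have a contact of order `n - 1`, then so do their images, and the jumps of the
`n`-th derivatives are proportional. -/
theorem lead_image {δ y' : ℝ → ℝ} {k : ℕ} {a b : ℝ} (hρ : ContDiffAt ℝ ∞ ρ (z, w z))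
    (hψ : ContDiffAt ℝ ∞ ψ (z, w z)) (h : CurveMapsTo ρ ψ w y z)
    (h' : CurveMapsTo ρ ψ (fun x => w x + δ x) y' z) (hδ : ContDiffAt ℝ ∞ δ z)
    (hl : Lead z (k + 2) a b δ) :
    ∃ b', Lead (ρ (z, w z)) (k + 2) (jac ρ ψ (z, w z) * a /
      (pdz ρ (z, w z) + pdw ρ (z, w z) * deriv w z) ^ (k + 3)) b' (y' - y) := by
  have hw := h.smooth_w
  have h0 : δ z = 0 := hl.1
  have h1 : deriv δ z = 0 := hl.2.1
  set X : ℝ → ℝ := fun x => ρ (x, w x) with hX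
  set χ := incr ρ w δ with hχ
  set X' : ℝ → ℝ := fun x => ρ (x, w x + δ x) with hX'
  have hXX : X' = fun x => X x + χ x := by funext x; simp [hX, hχ, hX', incr]
  have sX : ContDiffAt ℝ ∞ X z := smoothAt_curve hρ hw
  have sχ : ContDiffAt ℝ ∞ χ z := smoothAt_incr hρ hw hδ h0
  have χ0 : χ z = 0 := by simp [hχ, incr, h0]
  have eX : X z = ρ (z, w z) := rfl
  have sX' : ContDiffAt ℝ ∞ X' z := by rw [hXX]; exact sX.add sχ
  have X'z : X' z = ρ (z, w z) := by simp [hX', h0]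
  have sy := h.smooth_y
  have sy' : ContDiffAt ℝ ∞ y' (ρ (z, w z)) := by simpa [h0] using h'.smooth_y
  have L1 := lead_incr hw hδ (k + 1) hρ hl
  have L2 := lead_incr hw hδ (k + 1) hψ hl
  -- Viewing `y` as a function of two variables makes `lead_incr` applicable to `y (X + χ) - y X`.
  have sY : ContDiffAt ℝ ∞ (fun q : ℝ × ℝ => y q.2) (z, X z) :=
    ContDiffAt.comp (z, X z) (g := y) sy contDiffAt_snd
  have L3 := lead_incr sX sχ (k + 1) sY L1
  rw [pdw_comp_snd (differentiableAt_of_smoothAt sy)] at L3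
  have L4 := L2.sub L3 (smoothAt_incr hψ hw hδ h0) (smoothAt_incr sY sX sχ χ0)
  -- At the new abscissa `X' = X + χ`, the difference `y' - y` is the increment of `ψ` minus that of
  -- `y` along `X`. Its leading coefficient is `(ψ_w - y_x ρ_w) a`, which is the Jacobian times `a`
  -- divided by `T = ρ_z + ρ_w w'`; passing from `z` to `x` divides by `T^n` more, with `n = k + 2`.
  have L5 := L4.congr (g := (y' - y) ∘ X') (by
    have e1 : ∀ᶠ x in 𝓝 z, y' (X' x) = ψ (x, w x + δ x) := h'.eventually_eq
    have e2 : ∀ᶠ x in 𝓝 z, y (X x) = ψ (x, w x) := h.eventually_eq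
    filter_upwards [e1, e2] with x e1 e2
    have e3 : X' x = X x + χ x := congrFun hXX x
    simp only [incr, Pi.sub_apply, Function.comp, e1, e2, ← e3]
    ring)
  have dX' : deriv X' z = pdz ρ (z, w z) + pdw ρ (z, w z) * deriv w z := by
    have := deriv_curve (f := ρ) (w := fun x => w x + δ x) (z := z)
      (by simpa [h0] using differentiableAt_of_smoothAt hρ)
      (differentiableAt_of_smoothAt (hw.add hδ))
    rw [deriv_fun_add (differentiableAt_of_smoothAt hw) (differentiableAt_of_smoothAt hδ)] at this
    simpa [h0, h1] using this
  have ht := transversal_eq hρ h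
  have sd : ContDiffAt ℝ ∞ (y' - y) (X' z) := by rw [X'z]; exact sy'.sub sy
  obtain ⟨A, B, L6⟩ := L5.exists_of_comp sd sX' (by rwa [dX'])
  have L7 := (L6.comp sd sX' (by rwa [dX'])).unique L5
  rw [X'z] at L6
  refine ⟨B, L6.cast ?_ rfl⟩
  have e := L7.1
  have e' := deriv_image hρ hψ h
  rw [dX'] at e
  rw [eq_div_iff (pow_ne_zero _ ht)]
  have : A * (pdz ρ (z, w z) + pdw ρ (z, w z) * deriv w z) ^ (k + 1 + 1)
      * (pdz ρ (z, w z) + pdw ρ (z, w z) * deriv w z) = jac ρ ψ (z, w z) * a := by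
    rw [e]
    simp only [hX]
    rw [jac]
    linear_combination (-(pdw ρ (z, w z) * a)) * e'
  rw [← this]; ring

/-- Change of `Ω` under a change of the curve that vanishes to order `n - 1`. -/
theorem Omega_add_sub {F : ℝ × ℝ → ℝ} {δ : ℝ → ℝ} {k : ℕ} {μ ν : ℝ}
    (hF : ContDiffAt ℝ ∞ F (z, w z)) (hw : ContDiffAt ℝ ∞ w z) (hδ : ContDiffAt ℝ ∞ δ z)
    (hl : Lead z (k + 1) μ ν δ) :
    Omega F (k + 2) (fun x => w x + δ x) z - Omega F (k + 2) w z
      = ν + ((k + 2) * F (z, w z) + w z * pdw F (z, w z)) * μ := by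
  have h := iterate_opc_add_sub (k := k) (smoothAt_curve hF hw)
    (smoothAt_incr hF hw hδ hl.1) hw hδ (lead_incr hw hδ k hF hl) hl
  have e : ((fun x => F (x, w x)) + incr F w δ) = fun x => F (x, w x + δ x) := by
    funext x; simp [incr]
  rw [e] at h
  rw [Omega_eq_iterate, Omega_eq_iterate]
  refine Eq.trans h ?_
  ring

theorem Omega_add_sub_of_lead {F : ℝ × ℝ → ℝ} {δ : ℝ → ℝ} {k : ℕ} {μ ν : ℝ}
    (hF : ContDiffAt ℝ ∞ F (z, w z)) (hw : ContDiffAt ℝ ∞ w z) (hδ : ContDiffAt ℝ ∞ δ z)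
    (hl : Lead z (k + 2) μ ν δ) :
    Omega F (k + 2) (fun x => w x + δ x) z - Omega F (k + 2) w z = μ := by
  rw [Omega_add_sub hF hw hδ hl.lower]; ring

/-- Changing the `n`-th derivative of a curve, everything of lower order being fixed. -/
theorem exists_perturbation {F : ℝ × ℝ → ℝ} (k : ℕ) (hρ : ContDiffAt ℝ ∞ ρ (z, w z))
    (hψ : ContDiffAt ℝ ∞ ψ (z, w z)) (hF : ContDiffAt ℝ ∞ F (ρ (z, w z), ψ (z, w z)))
    (h : CurveMapsTo ρ ψ w y z) (ν : ℝ) :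
    ∃ w' y', CurveMapsTo ρ ψ w' y' z ∧ w' z = w z ∧
      Omega F (k + 2) y' (ρ (z, w z)) = Omega F (k + 2) y (ρ (z, w z)) + jac ρ ψ (z, w z) * ν /
        (pdz ρ (z, w z) + pdw ρ (z, w z) * deriv w z) ^ (k + 3) ∧
      ∀ Q : ℝ × ℝ → ℝ, ContDiffAt ℝ ∞ Q (z, w z) →
        Omega Q (k + 2) w' z = Omega Q (k + 2) w z + ν := by
  set δ : ℝ → ℝ := fun x => (ν / (k + 2).factorial) * (x - z) ^ (k + 2) with hδ
  have sδ : ContDiffAt ℝ ∞ δ z :=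
    contDiffAt_const.mul ((contDiffAt_id.sub contDiffAt_const).pow _)
  have L : Lead z (k + 2) ν 0 δ := (lead_pow z _ _).cast
    (div_mul_cancel₀ _ (by exact_mod_cast Nat.factorial_ne_zero _)) rfl
  have hw := h.smooth_w
  have h0 : δ z = 0 := L.1
  have h1 : deriv δ z = 0 := L.2.1
  have ht := transversal_eq hρ h
  obtain ⟨y', h'⟩ : ∃ y', CurveMapsTo ρ ψ (fun x => w x + δ x) y' z := by
    apply exists_curveMapsTo
    · simpa [h0] using hρ
    · simpa [h0] using hψ
    · exact hw.add sδ
    · rw [deriv_fun_add (differentiableAt_of_smoothAt hw) (differentiableAt_of_smoothAt sδ)]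
      simpa [h0, h1] using ht
  refine ⟨_, y', h', by simp [h0], ?_, fun Q hQ => ?_⟩
  · obtain ⟨b', L'⟩ := lead_image hρ hψ h h' sδ L
    have sy' : ContDiffAt ℝ ∞ y' (ρ (z, w z)) := by simpa [h0] using h'.smooth_y
    have ey : y (ρ (z, w z)) = ψ (z, w z) := h.eventually_eq.self_of_nhds
    have := Omega_add_sub_of_lead (F := F) (by rwa [ey]) h.smooth_y (sy'.sub h.smooth_y) L'
    rw [← this]
    simp
  · rw [← Omega_add_sub_of_lead hQ hw sδ L]; ring

/-- Corresponding equations of order at least two are proportional on all curves. -/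
theorem TransformsEq.mul_Omega_eq {F Q : ℝ × ℝ → ℝ} {k : ℕ} {S : Set (ℝ × ℝ)}
    (hT : TransformsEq (k + 2) ρ ψ F Q S) (hS : (z, w z) ∈ S)
    (hρ : ContDiffAt ℝ ∞ ρ (z, w z))
    (hψ : ContDiffAt ℝ ∞ ψ (z, w z)) (hF : ContDiffAt ℝ ∞ F (ρ (z, w z), ψ (z, w z)))
    (hQ : ContDiffAt ℝ ∞ Q (z, w z)) (h : CurveMapsTo ρ ψ w y z) :
    (pdz ρ (z, w z) + pdw ρ (z, w z) * deriv w z) ^ (k + 3) * Omega F (k + 2) y (ρ (z, w z))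
      = jac ρ ψ (z, w z) * Omega Q (k + 2) w z := by
  -- The perturbation is chosen to make the transformed equation hold; the original one then holds
  -- too, and its known affine change gives the proportionality.
  obtain ⟨w', y', h', e0, e1, e2⟩ :=
    exists_perturbation k hρ hψ hF h (-Omega Q (k + 2) w z)
  have e3 := e2 Q hQ
  rw [add_neg_cancel] at e3
  have e4 := (hT w' y' z h' (by rwa [e0])).2 e3
  rw [e0, e1] at e4
  have ht := pow_ne_zero (k + 3) (transversal_eq hρ h)
  field_simp at e4
  linear_combination e4

theorem exists_transversal {a b : ℝ} (h : a ≠ 0 ∨ b ≠ 0) : ∃ s : ℝ, a + b * s ≠ 0 := by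
  by_cases ha : a = 0
  · exact ⟨1, by rcases h with h | h <;> simp_all⟩
  · exact ⟨0, by simpa using ha⟩

theorem smoothAt_line (z w₀ s : ℝ) : ContDiffAt ℝ ∞ (fun x : ℝ => w₀ + s * (x - z)) z := by
  fun_prop

theorem deriv_line (z w₀ s x : ℝ) : deriv (fun x : ℝ => w₀ + s * (x - z)) x = s := by
  simp

theorem exists_line_curveMapsTo {p : ℝ × ℝ} (hρ : ContDiffAt ℝ ∞ ρ p)
    (hψ : ContDiffAt ℝ ∞ ψ p) {s : ℝ} (hs : pdz ρ p + pdw ρ p * s ≠ 0) :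
    ∃ y, CurveMapsTo ρ ψ (fun x => p.2 + s * (x - p.1)) y p.1 := by
  apply exists_curveMapsTo
  · simpa using hρ
  · simpa using hψ
  · exact smoothAt_line _ _ _
  · rw [deriv_line]; simpa using hs

/-- The derivative of order `n ≥ 2` does not affect transversality, so on any transversal line it
can be adjusted to solve the equation. -/
theorem isRegularFor_of_two_le {F : ℝ × ℝ → ℝ} (k : ℕ) {p : ℝ × ℝ} (hρ : ContDiffAt ℝ ∞ ρ p)
    (hψ : ContDiffAt ℝ ∞ ψ p) (hF : ContDiffAt ℝ ∞ F (ρ p, ψ p)) (hJ : jac ρ ψ p ≠ 0) :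
    IsRegularFor (k + 2) ρ ψ F p := by
  obtain ⟨s, hs⟩ : ∃ s : ℝ, pdz ρ p + pdw ρ p * s ≠ 0 := by
    apply exists_transversal
    by_contra! h
    exact hJ (by rw [jac, h.1, h.2]; ring)
  obtain ⟨y, h⟩ := exists_line_curveMapsTo hρ hψ hs
  have ep : (p.1, p.2 + s * (p.1 - p.1)) = p := by simp
  have hs' : pdz ρ p + pdw ρ p * deriv (fun x : ℝ => p.2 + s * (x - p.1)) p.1 ≠ 0 := by
    rwa [deriv_line]
  set t := (pdz ρ p + pdw ρ p * deriv (fun x : ℝ => p.2 + s * (x - p.1)) p.1) ^ (k + 3)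
  have ht : t ≠ 0 := pow_ne_zero _ hs'
  obtain ⟨w', y', h', e0, e1, -⟩ := exists_perturbation (F := F) k (by rwa [ep]) (by rwa [ep])
    (by rwa [ep]) h (-(Omega F (k + 2) y (ρ p)) * t / jac ρ ψ p)
  refine ⟨w', y', h', by simpa using e0, ?_⟩
  rw [ep] at e1
  rw [e1]
  change _ + _ / t = 0
  field_simp
  ring

end Curves

/-! ### Point transformations and the case of order one -/

section PointTransf

variable {U : Set (ℝ × ℝ)} {ρ ψ F : ℝ × ℝ → ℝ} {p : ℝ × ℝ}

theorem IsPointTransf.smoothAt_fst (h : IsPointTransf U ρ ψ) (hp : p ∈ U) :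
    ContDiffAt ℝ ∞ ρ p := h.smooth_fst.contDiffAt (h.isOpen.mem_nhds hp)

theorem IsPointTransf.smoothAt_snd (h : IsPointTransf U ρ ψ) (hp : p ∈ U) :
    ContDiffAt ℝ ∞ ψ p := h.smooth_snd.contDiffAt (h.isOpen.mem_nhds hp)

theorem IsPointTransf.jac_ne_zero (h : IsPointTransf U ρ ψ) (hp : p ∈ U) : jac ρ ψ p ≠ 0 :=
  h.jacobian_ne_zero p hp

theorem IsPointTransf.imageOf_mem_nhds (h : IsPointTransf U ρ ψ) (hp : p ∈ U) :
    imageOf U ρ ψ ∈ 𝓝 (ρ p, ψ p) := by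
  have hs : ContDiffAt ℝ ∞ (fun q => (ρ q, ψ q)) p :=
    (h.smoothAt_fst hp).prodMk (h.smoothAt_snd hp)
  have hd := hs.hasStrictFDerivAt (by simp)
  have hf : fderiv ℝ (fun q => (ρ q, ψ q)) p = (fderiv ℝ ρ p).prod (fderiv ℝ ψ p) :=
    ((differentiableAt_of_smoothAt (h.smoothAt_fst hp)).hasFDerivAt.prodMk
      (differentiableAt_of_smoothAt (h.smoothAt_snd hp)).hasFDerivAt).fderiv
  have hJ := h.jac_ne_zero hp
  have hr : (fderiv ℝ (fun q => (ρ q, ψ q)) p).range = ⊤ := by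
    refine LinearMap.range_eq_top.2 fun v => ?_
    -- Cramer's rule.
    refine ⟨((pdw ψ p * v.1 - pdw ρ p * v.2) / jac ρ ψ p,
      (pdz ρ p * v.2 - pdz ψ p * v.1) / jac ρ ψ p), ?_⟩
    rw [hf]
    ext
    · simp only [ContinuousLinearMap.coe_coe, ContinuousLinearMap.prod_apply, fderiv_apply_eq]
      field_simp
      rw [jac]; ring
    · simp only [ContinuousLinearMap.coe_coe, ContinuousLinearMap.prod_apply, fderiv_apply_eq]
      field_simp
      rw [jac]; ring
  rw [← hd.map_nhds_eq_of_surj hr]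
  exact image_mem_map (h.isOpen.mem_nhds hp)

theorem IsPointTransf.smoothAt_param (h : IsPointTransf U ρ ψ)
    (hF : ContDiffOn ℝ ∞ F (imageOf U ρ ψ)) (hp : p ∈ U) : ContDiffAt ℝ ∞ F (ρ p, ψ p) :=
  hF.contDiffAt (h.imageOf_mem_nhds hp)

theorem IsPointTransf.smoothAt_param_comp (h : IsPointTransf U ρ ψ)
    (hF : ContDiffOn ℝ ∞ F (imageOf U ρ ψ)) (hp : p ∈ U) :
    ContDiffAt ℝ ∞ (fun q => F (ρ q, ψ q)) p :=
  ContDiffAt.comp p (g := F) (f := fun q => (ρ q, ψ q)) (h.smoothAt_param hF hp)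
    ((h.smoothAt_fst hp).prodMk (h.smoothAt_snd hp))

theorem Omega_one (F : ℝ × ℝ → ℝ) (y : ℝ → ℝ) (x : ℝ) :
    Omega F 1 y x = deriv y x + F (x, y x) * y x := rfl

/-- Along corresponding curves, the first order equation reads `den · w' + num = 0`. -/
theorem mul_Omega_one {w y : ℝ → ℝ} {z : ℝ} (hρ : ContDiffAt ℝ ∞ ρ (z, w z))
    (hψ : ContDiffAt ℝ ∞ ψ (z, w z)) (h : CurveMapsTo ρ ψ w y z) :
    (pdz ρ (z, w z) + pdw ρ (z, w z) * deriv w z) * Omega F 1 y (ρ (z, w z))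
      = den ρ ψ F (z, w z) * deriv w z
        + (F (ρ (z, w z), ψ (z, w z)) * ψ (z, w z) * pdz ρ (z, w z) + pdz ψ (z, w z)) := by
  have e := deriv_image hρ hψ h
  have ey : y (ρ (z, w z)) = ψ (z, w z) := h.eventually_eq.self_of_nhds
  rw [Omega_one, ey, den]
  linear_combination e

/-- With `N` the numerator of `Q₁`, one has `ρ_z * den - ρ_w * N = jac`. If `den = 0`, a solution
would force `N = 0` and hence a zero Jacobian; otherwise the required slope `-N / den` is
transversal because `ρ_z + ρ_w * (-N / den) = jac / den`. -/
theorem IsPointTransf.isRegularFor_one_iff (h : IsPointTransf U ρ ψ) (hp : p ∈ U) :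
    IsRegularFor 1 ρ ψ F p ↔ den ρ ψ F p ≠ 0 := by
  have hρ := h.smoothAt_fst hp
  have hψ := h.smoothAt_snd hp
  have hJ := h.jac_ne_zero hp
  constructor
  · rintro ⟨w, y, hc, hw, hO⟩ hd
    have ep : (p.1, w p.1) = p := by rw [hw]
    have e := mul_Omega_one (F := F) (by rwa [ep]) (by rwa [ep]) hc
    rw [ep, hO, hd, mul_zero, zero_mul, zero_add] at e
    apply hJ
    rw [den] at hd
    rw [jac]
    linear_combination pdz ρ p * hd + pdw ρ p * e
  · intro hd
    set N := F (ρ p, ψ p) * ψ p * pdz ρ p + pdz ψ p with hN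
    have ht : (pdz ρ p + pdw ρ p * (-N / den ρ ψ F p)) = jac ρ ψ p / den ρ ψ F p := by
      field_simp
      rw [den, hN, jac]; ring
    have hs : pdz ρ p + pdw ρ p * (-N / den ρ ψ F p) ≠ 0 := by
      rw [ht]; exact div_ne_zero hJ hd
    obtain ⟨y, hc⟩ := exists_line_curveMapsTo hρ hψ hs
    have ep : (p.1, p.2 + -N / den ρ ψ F p * (p.1 - p.1)) = p := by simp
    have e := mul_Omega_one (F := F) (by rwa [ep]) (by rwa [ep]) hc
    rw [deriv_line, ep, ← hN, mul_div_cancel₀ _ hd, neg_add_cancel] at e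
    exact ⟨_, y, hc, by simp, (mul_eq_zero.1 e).resolve_left hs⟩

theorem IsPointTransf.smoothAt_den (h : IsPointTransf U ρ ψ)
    (hF : ContDiffOn ℝ ∞ F (imageOf U ρ ψ)) (hp : p ∈ U) : ContDiffAt ℝ ∞ (den ρ ψ F) p :=
  (((h.smoothAt_param_comp hF hp).mul (h.smoothAt_snd hp)).mul
    (smoothAt_pdw (h.smoothAt_fst hp))).add (smoothAt_pdw (h.smoothAt_snd hp))

theorem IsPointTransf.contDiffOn_Q₁ (h : IsPointTransf U ρ ψ)
    (hF : ContDiffOn ℝ ∞ F (imageOf U ρ ψ)) :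
    ContDiffOn ℝ ∞ (Q₁ ρ ψ F) {p | p ∈ U ∧ p.2 ≠ 0 ∧ den ρ ψ F p ≠ 0} := by
  rintro p ⟨hp, hp2, hd⟩
  refine ContDiffAt.contDiffWithinAt ?_
  exact ((((h.smoothAt_param_comp hF hp).mul (h.smoothAt_snd hp)).mul
    (smoothAt_pdz (h.smoothAt_fst hp))).add (smoothAt_pdz (h.smoothAt_snd hp))).div
    (contDiffAt_snd.mul (h.smoothAt_den hF hp)) (mul_ne_zero hp2 hd)

theorem IsPointTransf.transformsEq_one (h : IsPointTransf U ρ ψ) (F : ℝ × ℝ → ℝ) :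
    TransformsEq 1 ρ ψ F (Q₁ ρ ψ F) {p | p ∈ U ∧ p.2 ≠ 0 ∧ den ρ ψ F p ≠ 0} := by
  rintro w y z hc ⟨hp, hp2, hd⟩
  have hρ := h.smoothAt_fst hp
  have e := mul_Omega_one (F := F) hρ (h.smoothAt_snd hp) hc
  have ht := transversal_eq hρ hc
  have e2 : den ρ ψ F (z, w z) * Omega (Q₁ ρ ψ F) 1 w z = den ρ ψ F (z, w z) * deriv w z
      + (F (ρ (z, w z), ψ (z, w z)) * ψ (z, w z) * pdz ρ (z, w z) + pdz ψ (z, w z)) := by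
    change w z ≠ 0 at hp2
    rw [Omega_one, Q₁]
    field_simp
  rw [← e2] at e
  constructor
  · intro h0
    rw [h0, mul_zero] at e
    exact (mul_eq_zero.1 e.symm).resolve_left hd
  · intro h0
    rw [h0, mul_zero] at e
    exact (mul_eq_zero.1 e).resolve_left ht

theorem IsPointTransf.isEquivTransf_one (h : IsPointTransf U ρ ψ) : IsEquivTransf 1 U ρ ψ := by
  refine ⟨h, fun F hF => ⟨Q₁ ρ ψ F, ?_⟩⟩
  have e : {p | p ∈ U ∧ p.2 ≠ 0 ∧ IsRegularFor 1 ρ ψ F p}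
      = {p | p ∈ U ∧ p.2 ≠ 0 ∧ den ρ ψ F p ≠ 0} := by
    ext p
    refine and_congr_right fun hp => and_congr_right fun _ => h.isRegularFor_one_iff hp
  rw [e]
  exact ⟨h.contDiffOn_Q₁ hF, h.transformsEq_one F⟩

end PointTransf

/-! ### Bol's lemma and change of the independent variable -/

section Bol

variable {z : ℝ}

/-- Conjugation of `d/dz + q` by a function. -/
theorem mul_iterate_opc {θ q G : ℝ → ℝ} (hθ : ContDiffAt ℝ ∞ θ z) (hq : ContDiffAt ℝ ∞ q z)
    (h : q * θ =ᶠ[𝓝 z] G * θ + deriv θ) (n : ℕ) : ∀ {w : ℝ → ℝ}, ContDiffAt ℝ ∞ w z →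
    θ * (opc q)^[n] w =ᶠ[𝓝 z] (opc G)^[n] (θ * w) := by
  induction n with
  | zero => intro w _; exact EventuallyEq.rfl
  | succ n ih =>
    intro w hw
    refine (ih (smoothAt_opc hq hw)).trans (iterate_opc_congr EventuallyEq.rfl n ?_)
    filter_upwards [h, deriv_mul_eventuallyEq hθ hw] with x h1 h2
    simp only [opc, Pi.add_apply, Pi.mul_apply] at h1 h2 ⊢
    rw [h2]
    linear_combination w x * h1

/-- Leibniz rule, which stops after two terms since `t'' = 0`. This is the only place where Bol's
lemma needs more than one derivative of `t`. -/
theorem iterate_opc_affine_mul {G t : ℝ → ℝ} {κ : ℝ} (hG : ContDiffAt ℝ ∞ G z)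
    (ht : ContDiffAt ℝ ∞ t z) (hκ : ∀ x, deriv t x = κ) (n : ℕ) {u : ℝ → ℝ}
    (hu : ContDiffAt ℝ ∞ u z) :
    (opc G)^[n + 1] (t * u) =ᶠ[𝓝 z]
      t * (opc G)^[n + 1] u + (fun _ => (n + 1) * κ) * (opc G)^[n] u := by
  induction n with
  | zero =>
    filter_upwards [deriv_mul_eventuallyEq ht hu] with x h
    simp only [Function.iterate_succ_apply, Function.iterate_zero, id, opc, Pi.add_apply,
      Pi.mul_apply] at h ⊢
    rw [h, hκ]; push_cast; ring
  | succ n ih =>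
    have s1 := smoothAt_iterate_opc hG (n + 1) hu
    have s0 := smoothAt_iterate_opc hG n hu
    have sc : ContDiffAt ℝ ∞ (fun _ : ℝ => (n + 1) * κ) z := contDiffAt_const
    rw [Function.iterate_succ_apply' _ (n + 1) (t * u)]
    refine (opc_congr EventuallyEq.rfl ih).trans ?_
    filter_upwards [deriv_add_eventuallyEq (f := t * (opc G)^[n + 1] u)
        (g := (fun _ => (n + 1) * κ) * (opc G)^[n] u) (ht.mul s1) (sc.mul s0),
      deriv_mul_eventuallyEq ht s1, deriv_mul_eventuallyEq sc s0] with x h1 h2 h3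
    rw [Function.iterate_succ_apply' _ (n + 1) u]
    have e : (opc G)^[n + 1] u x = deriv ((opc G)^[n] u) x + G x * (opc G)^[n] u x := by
      rw [Function.iterate_succ_apply']; rfl
    simp only [opc, Pi.add_apply, Pi.mul_apply] at h1 h2 h3 ⊢
    rw [h1, h2, h3, hκ, e]
    simp only [deriv_const]
    push_cast; ring

/-- Bol's lemma: `(t² (d/dz + G))^n v = t^(n+1) (d/dz + G)^n (t^(n-1) v)` for affine `t`. -/
theorem bol {G t : ℝ → ℝ} {κ : ℝ} (hG : ContDiffAt ℝ ∞ G z)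
    (ht : ContDiffAt ℝ ∞ t z) (hκ : ∀ x, deriv t x = κ) (j : ℕ) {v : ℝ → ℝ}
    (hv : ContDiffAt ℝ ∞ v z) :
    (fun f => t ^ 2 * opc G f)^[j + 1] v =ᶠ[𝓝 z] t ^ (j + 2) * (opc G)^[j + 1] (t ^ j * v) := by
  induction j with
  | zero =>
    refine EventuallyEq.of_eq ?_
    simp
  | succ j ih =>
    rw [Function.iterate_succ_apply' _ (j + 1)]
    have su : ContDiffAt ℝ ∞ (t ^ j * v) z := (ht.pow j).mul hv
    have s1 := smoothAt_iterate_opc hG (j + 1) su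
    have e : t ^ (j + 1) * v = t * (t ^ j * v) := by ring
    rw [e]
    filter_upwards [opc_congr (q := G) EventuallyEq.rfl ih,
      iterate_opc_affine_mul hG ht hκ (j + 1) su,
      deriv_mul_eventuallyEq (f := t ^ (j + 2)) (ht.pow (j + 2)) s1, differentiableAt_eventually ht]
      with x h1 h2 h3 h4
    have e3 : deriv (t ^ (j + 2)) x = (j + 2) * t x ^ (j + 1) * κ := by
      rw [deriv_pow h4, hκ]; push_cast; simp
    have e4 : (opc G)^[j + 1 + 1] (t ^ j * v) x = deriv ((opc G)^[j + 1] (t ^ j * v)) x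
        + G x * (opc G)^[j + 1] (t ^ j * v) x := by
      rw [Function.iterate_succ_apply']; rfl
    simp only [Pi.mul_apply, Pi.pow_apply, Pi.add_apply] at h1 h2 h3 ⊢
    rw [h1, h2, opc_apply, h3, e3, e4, Pi.mul_apply, Pi.pow_apply]
    push_cast
    ring

theorem opc_comp {q g m : ℝ → ℝ} (hg : ContDiffAt ℝ ∞ g (m z))
    (hm : ContDiffAt ℝ ∞ m z) (hm0 : deriv m z ≠ 0) :
    opc q g ∘ m =ᶠ[𝓝 z] (deriv m)⁻¹ * opc ((q ∘ m) * deriv m) (g ∘ m) := by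
  filter_upwards [deriv_comp_eventuallyEq hg hm,
    (smoothAt_deriv hm).continuousAt.eventually_ne hm0] with x h1 h2
  simp only [opc, Pi.add_apply, Pi.mul_apply, Pi.inv_apply, Function.comp] at h1 ⊢
  rw [h1]
  field_simp

/-- Under `x = m(z)` the operator `d/dx + q` becomes `(1 / m') (d/dz + (q ∘ m) m')`. -/
theorem iterate_opc_comp {q m a G : ℝ → ℝ} (hq : ContDiffAt ℝ ∞ q (m z))
    (hm : ContDiffAt ℝ ∞ m z) (hm0 : deriv m z ≠ 0) (ha : (deriv m)⁻¹ =ᶠ[𝓝 z] a)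
    (hG : (q ∘ m) * deriv m =ᶠ[𝓝 z] G) (n : ℕ) :
    ∀ {g v : ℝ → ℝ}, ContDiffAt ℝ ∞ g (m z) → g ∘ m =ᶠ[𝓝 z] v →
    (opc q)^[n] g ∘ m =ᶠ[𝓝 z] (fun f => a * opc G f)^[n] v := by
  induction n with
  | zero => intro g v _ h; exact h
  | succ n ih =>
    intro g v hg h
    exact ih (smoothAt_opc hq hg) ((opc_comp hg hm hm0).trans (ha.mul (opc_congr hG h)))

theorem iterate_const_mul (c : ℝ) (t G : ℝ → ℝ) (n : ℕ) : ∀ v : ℝ → ℝ,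
    (fun f => (c • t) * opc G f)^[n] v = c ^ n • (fun f => t * opc G f)^[n] v := by
  induction n with
  | zero => intro v; simp
  | succ n ih =>
    intro v
    rw [Function.iterate_succ_apply', Function.iterate_succ_apply', ih, opc_smul]
    rw [pow_succ, smul_mul_smul_comm, mul_comm c]

end Bol

/-! ### Partial derivatives of functions of `z` and of functions affine in `w` -/

section Fibred

variable {m R S : ℝ → ℝ} {p : ℝ × ℝ}

theorem hasFDerivAt_comp_fst (hm : DifferentiableAt ℝ m p.1) :
    HasFDerivAt (fun q : ℝ × ℝ => m q.1)
      ((ContinuousLinearMap.toSpanSingleton ℝ (deriv m p.1)).comp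
        (ContinuousLinearMap.fst ℝ ℝ ℝ)) p :=
  hm.hasDerivAt.hasFDerivAt.comp p hasFDerivAt_fst

theorem pdz_comp_fst (hm : DifferentiableAt ℝ m p.1) :
    pdz (fun q => m q.1) p = deriv m p.1 := by
  rw [pdz, (hasFDerivAt_comp_fst hm).fderiv]; simp

theorem pdw_comp_fst (hm : DifferentiableAt ℝ m p.1) : pdw (fun q => m q.1) p = 0 := by
  rw [pdw, (hasFDerivAt_comp_fst hm).fderiv]; simp

theorem pdz_affine (hR : DifferentiableAt ℝ R p.1) (hS : DifferentiableAt ℝ S p.1) :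
    pdz (fun q => R q.1 * q.2 + S q.1) p = deriv R p.1 * p.2 + deriv S p.1 := by
  rw [pdz, (((hasFDerivAt_comp_fst hR).fun_mul hasFDerivAt_snd).fun_add
    (hasFDerivAt_comp_fst hS)).fderiv]
  simp [mul_comm]

theorem pdw_affine (hR : DifferentiableAt ℝ R p.1) (hS : DifferentiableAt ℝ S p.1) :
    pdw (fun q => R q.1 * q.2 + S q.1) p = R p.1 := by
  rw [pdw, (((hasFDerivAt_comp_fst hR).fun_mul hasFDerivAt_snd).fun_add
    (hasFDerivAt_comp_fst hS)).fderiv]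
  simp

theorem pdz_congr {f g : ℝ × ℝ → ℝ} (h : f =ᶠ[𝓝 p] g) : pdz f p = pdz g p := by
  rw [pdz, pdz, h.fderiv_eq]

theorem pdw_congr {f g : ℝ × ℝ → ℝ} (h : f =ᶠ[𝓝 p] g) : pdw f p = pdw g p := by
  rw [pdw, pdw, h.fderiv_eq]

end Fibred

/-! ### Derivatives of a fractional linear function -/

section Mobius

variable {k₁ k₂ k₃ k₄ : ℝ} {z : ℝ}

theorem hasDerivAt_mobius (h : k₄ * z + k₃ ≠ 0) :
    HasDerivAt (mobius k₁ k₂ k₃ k₄) ((k₂ * k₃ - k₁ * k₄) / (k₄ * z + k₃) ^ 2) z := by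
  have h1 : HasDerivAt (fun x => k₂ * x + k₁) k₂ z := by
    simpa using ((hasDerivAt_id z).const_mul k₂).add_const k₁
  have h2 : HasDerivAt (fun x => k₄ * x + k₃) k₄ z := by
    simpa using ((hasDerivAt_id z).const_mul k₄).add_const k₃
  exact (h1.div h2 h).congr_deriv (by congr 1; ring)

theorem eventually_denom_ne_zero (h : k₄ * z + k₃ ≠ 0) : ∀ᶠ x in 𝓝 z, k₄ * x + k₃ ≠ 0 :=
  (Continuous.continuousAt (by fun_prop)).eventually_ne h

theorem deriv_mobius (h : k₄ * z + k₃ ≠ 0) :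
    deriv (mobius k₁ k₂ k₃ k₄) =ᶠ[𝓝 z] fun x => (k₂ * k₃ - k₁ * k₄) / (k₄ * x + k₃) ^ 2 := by
  filter_upwards [eventually_denom_ne_zero h] with x hx using (hasDerivAt_mobius hx).deriv

theorem deriv_deriv_mobius (h : k₄ * z + k₃ ≠ 0) :
    deriv (deriv (mobius k₁ k₂ k₃ k₄)) z
      = -2 * k₄ * (k₂ * k₃ - k₁ * k₄) / (k₄ * z + k₃) ^ 3 := by
  rw [(deriv_mobius h).deriv_eq]
  have h2 : HasDerivAt (fun x => k₄ * x + k₃) k₄ z := by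
    simpa using ((hasDerivAt_id z).const_mul k₄).add_const k₃
  have h3 := ((h2.pow 2).inv (pow_ne_zero 2 h)).const_mul (k₂ * k₃ - k₁ * k₄)
  refine (h3.congr_deriv ?_).deriv
  rw [Pi.pow_apply]
  field_simp
  push_cast; ring

theorem smoothAt_mobius (h : k₄ * z + k₃ ≠ 0) : ContDiffAt ℝ ∞ (mobius k₁ k₂ k₃ k₄) z :=
  ContDiffAt.div (by fun_prop) (by fun_prop) h

end Mobius

/-! ### Sufficiency of the Moebius form -/

section MobiusForm

variable {U : Set (ℝ × ℝ)} {ρ ψ F : ℝ × ℝ → ℝ} {k₁ k₂ k₃ k₄ : ℝ} {R : ℝ → ℝ} {p : ℝ × ℝ}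

theorem HasMobiusForm.smoothAt_R (h : HasMobiusForm U ρ ψ k₁ k₂ k₃ k₄ R) (hU : IsOpen U)
    (hp : p ∈ U) : ContDiffAt ℝ ∞ R p.1 :=
  h.smooth_R.contDiffAt ((isOpenMap_fst U hU).mem_nhds ⟨p, hp, rfl⟩)

theorem HasMobiusForm.fst_eventuallyEq (h : HasMobiusForm U ρ ψ k₁ k₂ k₃ k₄ R)
    (hU : IsOpen U) (hp : p ∈ U) : ρ =ᶠ[𝓝 p] fun q => mobius k₁ k₂ k₃ k₄ q.1 := by
  filter_upwards [hU.mem_nhds hp] with q hq using h.fst_eq q hq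

theorem HasMobiusForm.snd_eventuallyEq (h : HasMobiusForm U ρ ψ k₁ k₂ k₃ k₄ R)
    (hU : IsOpen U) (hp : p ∈ U) :
    ψ =ᶠ[𝓝 p] fun q => R q.1 * q.2 + (fun _ : ℝ => (0 : ℝ)) q.1 := by
  filter_upwards [hU.mem_nhds hp] with q hq
  rw [h.snd_eq q hq, add_zero]

theorem HasMobiusForm.deriv_ne_zero (h : HasMobiusForm U ρ ψ k₁ k₂ k₃ k₄ R) (hp : p ∈ U) :
    deriv (mobius k₁ k₂ k₃ k₄) p.1 ≠ 0 := by
  rw [(hasDerivAt_mobius (h.no_pole p hp)).deriv]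
  exact div_ne_zero h.nondegenerate (pow_ne_zero 2 (h.no_pole p hp))

theorem HasMobiusForm.isPointTransf (h : HasMobiusForm U ρ ψ k₁ k₂ k₃ k₄ R) (hU : IsOpen U) :
    IsPointTransf U ρ ψ where
  isOpen := hU
  smooth_fst p hp := by
    refine ContDiffAt.contDiffWithinAt (ContDiffAt.congr_of_eventuallyEq ?_
      (h.fst_eventuallyEq hU hp))
    exact ContDiffAt.comp p (smoothAt_mobius (h.no_pole p hp)) contDiffAt_fst
  smooth_snd p hp := by
    refine ContDiffAt.contDiffWithinAt (ContDiffAt.congr_of_eventuallyEq ?_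
      (h.snd_eventuallyEq hU hp))
    exact ((ContDiffAt.comp p (h.smoothAt_R hU hp) contDiffAt_fst).mul contDiffAt_snd).add
      contDiffAt_const
  jacobian_ne_zero p hp := by
    have hR := differentiableAt_of_smoothAt (h.smoothAt_R hU hp)
    rw [pdz_congr (h.fst_eventuallyEq hU hp), pdw_congr (h.fst_eventuallyEq hU hp),
      pdw_congr (h.snd_eventuallyEq hU hp),
      pdz_comp_fst (differentiableAt_of_smoothAt (smoothAt_mobius (h.no_pole p hp))),
      pdw_comp_fst (differentiableAt_of_smoothAt (smoothAt_mobius (h.no_pole p hp))),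
      pdw_affine hR (differentiableAt_const _), zero_mul, sub_zero]
    exact mul_ne_zero (h.deriv_ne_zero hp) (h.R_ne_zero p hp)

theorem HasMobiusForm.contDiffOn_Qₙ (h : HasMobiusForm U ρ ψ k₁ k₂ k₃ k₄ R) (hU : IsOpen U)
    (n : ℕ) (hF : ContDiffOn ℝ ∞ F (imageOf U ρ ψ)) :
    ContDiffOn ℝ ∞ (Qₙ n F (mobius k₁ k₂ k₃ k₄) R) U := by
  intro p hp
  have hm : ContDiffAt ℝ ∞ (mobius k₁ k₂ k₃ k₄) p.1 := smoothAt_mobius (h.no_pole p hp)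
  have hR := h.smoothAt_R hU hp
  refine ContDiffAt.contDiffWithinAt (ContDiffAt.sub (ContDiffAt.add (ContDiffAt.mul ?_ ?_) ?_)
    (ContDiffAt.mul contDiffAt_const ?_))
  · refine ((h.isPointTransf hU).smoothAt_param_comp hF hp).congr_of_eventuallyEq ?_
    filter_upwards [hU.mem_nhds hp] with q hq
    rw [h.fst_eq q hq, h.snd_eq q hq]
  · exact ContDiffAt.comp p (smoothAt_deriv hm) contDiffAt_fst
  · exact ContDiffAt.comp p ((smoothAt_deriv hR).div hR (h.R_ne_zero p hp)) contDiffAt_fst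
  · exact ContDiffAt.comp p ((smoothAt_deriv (smoothAt_deriv hm)).div (smoothAt_deriv hm)
      (h.deriv_ne_zero hp)) contDiffAt_fst

/-- Change of variable, then Bol's lemma, then conjugation by `t^j R`, with `t = k₄ z + k₃`. The
factor `t^(j + 2)` from Bol and the `t^j` of the conjugation multiply to `t^(2 j + 2)`. -/
theorem HasMobiusForm.mul_Omega_eq (h : HasMobiusForm U ρ ψ k₁ k₂ k₃ k₄ R) (hU : IsOpen U)
    (j : ℕ) (hF : ContDiffOn ℝ ∞ F (imageOf U ρ ψ)) {w y : ℝ → ℝ} {z : ℝ}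
    (hc : CurveMapsTo ρ ψ w y z) (hp : (z, w z) ∈ U) :
    Omega F (j + 1) y (ρ (z, w z)) = ((k₂ * k₃ - k₁ * k₄)⁻¹ ^ (j + 1) *
      (k₄ * z + k₃) ^ (2 * j + 2) * R z) *
        Omega (Qₙ (j + 1) F (mobius k₁ k₂ k₃ k₄) R) (j + 1) w z := by
  set m := mobius k₁ k₂ k₃ k₄ with hm_def
  set Δ := k₂ * k₃ - k₁ * k₄ with hΔ
  set t : ℝ → ℝ := fun x => k₄ * x + k₃ with ht_def
  have hΔ0 : Δ ≠ 0 := h.nondegenerate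
  have ht0 : t z ≠ 0 := h.no_pole _ hp
  have st : ContDiffAt ℝ ∞ t z := by simp only [ht_def]; fun_prop
  have dt : ∀ x, deriv t x = k₄ := fun x => by
    have : HasDerivAt (fun x => k₄ * x + k₃) k₄ x := by
      simpa using ((hasDerivAt_id x).const_mul k₄).add_const k₃
    exact this.deriv
  have hP := h.isPointTransf hU
  have hw := hc.smooth_w
  have sm : ContDiffAt ℝ ∞ m z := smoothAt_mobius ht0
  have hm0 : deriv m z ≠ 0 := h.deriv_ne_zero hp
  have sR : ContDiffAt ℝ ∞ R z := h.smoothAt_R hU hp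
  have hR0 : R z ≠ 0 := h.R_ne_zero _ hp
  have hcurve : ∀ᶠ x in 𝓝 z, (x, w x) ∈ U := by
    have : ContinuousAt (fun x => (x, w x)) z := continuousAt_id.prodMk hw.continuousAt
    exact this (hU.mem_nhds hp)
  have emz : ρ (z, w z) = m z := h.fst_eq _ hp
  have eym : y ∘ m =ᶠ[𝓝 z] R * w := by
    filter_upwards [hc.eventually_eq, hcurve] with x h1 h2
    rw [h.fst_eq _ h2, h.snd_eq _ h2] at h1
    exact h1
  have sy : ContDiffAt ℝ ∞ y (m z) := emz ▸ hc.smooth_y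
  have sF : ContDiffAt ℝ ∞ F (m z, y (m z)) := by
    have e : y (ρ (z, w z)) = ψ (z, w z) := hc.eventually_eq.self_of_nhds
    rw [emz] at e
    have := hP.smoothAt_param hF hp
    rwa [← e, emz] at this
  have sq : ContDiffAt ℝ ∞ (fun x => F (x, y x)) (m z) := smoothAt_curve sF sy
  set G : ℝ → ℝ := ((fun x => F (x, y x)) ∘ m) * deriv m with hG
  have sG : ContDiffAt ℝ ∞ G z := (ContDiffAt.comp z sq sm).mul (smoothAt_deriv sm)
  -- Here the Moebius form enters: `1 / m'` is a constant times the square of an affine function.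
  have em' : (deriv m)⁻¹ =ᶠ[𝓝 z] Δ⁻¹ • t ^ 2 := by
    filter_upwards [deriv_mobius (k₁ := k₁) (k₂ := k₂) ht0] with x hx
    simp [hm_def, hx, ht_def, div_eq_mul_inv, hΔ, mul_comm]
  have e1 := (iterate_opc_comp sq sm hm0 em' (EventuallyEq.refl _ G) (j + 1) sy eym).eq_of_nhds
  have e2 := (bol (v := R * w) sG st dt j (sR.mul hw)).eq_of_nhds
  set θ : ℝ → ℝ := t ^ j * R with hθ
  have sθ : ContDiffAt ℝ ∞ θ z := (st.pow j).mul sR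
  set q : ℝ → ℝ := fun x => Qₙ (j + 1) F m R (x, w x) with hq
  have sQ : ContDiffAt ℝ ∞ q z := by
    refine smoothAt_curve ?_ hw
    exact (h.contDiffOn_Qₙ hU (j + 1) hF).contDiffAt (hU.mem_nhds hp)
  -- Equivalently `q = G + θ' / θ`: since `m'' / m' = -2 k₄ / t`, the part `j k₄ / t` of `θ' / θ`
  -- equals `-(j / 2) m'' / m'`.
  have eq : q * θ =ᶠ[𝓝 z] G * θ + deriv θ := by
    have st' := st.pow j
    filter_upwards [hcurve, eym, st.continuousAt.eventually_ne ht0,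
      sR.continuousAt.eventually_ne hR0,
      deriv_mul_eventuallyEq (f := t ^ j) st' sR, differentiableAt_eventually st]
      with x h1 h2 h3 h4 h5 h6
    -- The factor `t x` avoids the truncated exponent `j - 1` at `j = 0`.
    have h7 : deriv (t ^ j) x * t x = j * t x ^ j * k₄ := by
      rw [deriv_pow h6, dt]
      rcases j with _ | j
      · simp
      · simp only [Nat.add_sub_cancel]; ring
    have h8 : deriv (deriv m) x / deriv m x = -2 * k₄ / t x := by
      rw [hm_def, deriv_deriv_mobius h3, (hasDerivAt_mobius h3).deriv]
      simp only [ht_def] at h3 ⊢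
      rw [← hΔ]
      field_simp
    have h9 : deriv (t ^ j) x = j * t x ^ j * k₄ / t x := by rw [eq_div_iff h3, h7]
    have h2' : y (m x) = R x * w x := h2
    simp only [Pi.mul_apply, Pi.add_apply, hθ, h5, hq, Qₙ, hG, Function.comp, h8, h2', h9,
      Pi.pow_apply]
    field_simp
    push_cast
    ring
  have e3 := (mul_iterate_opc sθ sQ eq (j + 1) hw).eq_of_nhds
  have e4 : t ^ j * (R * w) = θ * w := by rw [hθ]; ring
  rw [iterate_const_mul] at e1
  rw [e4] at e2
  rw [emz, Omega_eq_iterate, Omega_eq_iterate]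
  simp only [Function.comp_apply, Pi.smul_apply, Pi.mul_apply, Pi.pow_apply, smul_eq_mul]
    at e1 e2 e3
  rw [e1, e2, ← e3]
  simp only [hθ, Pi.mul_apply, Pi.pow_apply]
  change _ = Δ⁻¹ ^ (j + 1) * t z ^ (2 * j + 2) * R z * _
  ring

theorem HasMobiusForm.transformsEq (h : HasMobiusForm U ρ ψ k₁ k₂ k₃ k₄ R) (hU : IsOpen U)
    (j : ℕ) (hF : ContDiffOn ℝ ∞ F (imageOf U ρ ψ)) :
    TransformsEq (j + 1) ρ ψ F (Qₙ (j + 1) F (mobius k₁ k₂ k₃ k₄) R) U := by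
  intro w y z hc hp
  have h1 : (k₂ * k₃ - k₁ * k₄)⁻¹ ^ (j + 1) * (k₄ * z + k₃) ^ (2 * j + 2) * R z ≠ 0 :=
    mul_ne_zero (mul_ne_zero (pow_ne_zero _ (inv_ne_zero h.nondegenerate))
      (pow_ne_zero _ (h.no_pole _ hp))) (h.R_ne_zero _ hp)
  rw [h.mul_Omega_eq hU j hF hc hp, mul_eq_zero, or_iff_right h1]

theorem HasMobiusForm.isEquivTransf (h : HasMobiusForm U ρ ψ k₁ k₂ k₃ k₄ R) (hU : IsOpen U)
    (j : ℕ) : IsEquivTransf (j + 1) U ρ ψ :=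
  ⟨h.isPointTransf hU, fun _ hF => ⟨_, (h.contDiffOn_Qₙ hU (j + 1) hF).mono fun _ hp => hp.1,
    fun w y z hc hp => h.transformsEq hU j hF w y z hc hp.1⟩⟩

end MobiusForm

/-! ### Polynomial dependence on a parameter -/

section PolynomialDependence

open Polynomial

/-- Expanding the recursion gives a sum over words in `A` and `B`, with one factor `τ` for each `B`;
only the word `B^n` reaches degree `n`. It serves both for a parameter in the coefficient and for
the slope of a line, where `A` is `∂_z + Q` and `B` is `∂_w`. -/
theorem exists_polynomial_of_recursion {M : Type*} {A B : M → M} {E : ℝ → ℕ → M → ℝ} {e : M → ℝ}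
    (h0 : ∀ τ a, E τ 0 a = e a)
    (h1 : ∀ τ n a, E τ (n + 1) a = E τ n (A a) + τ * E τ n (B a)) (n : ℕ) :
    ∀ a, ∃ P : ℝ[X], P.natDegree ≤ n ∧ P.coeff n = e (B^[n] a) ∧ ∀ τ, P.eval τ = E τ n a := by
  induction n with
  | zero => exact fun a => ⟨C (e a), by simp, by simp, fun τ => by simp [h0]⟩
  | succ n ih =>
    intro a
    obtain ⟨P, hP, -, hP'⟩ := ih (A a)
    obtain ⟨P', hd, hc, he⟩ := ih (B a)
    refine ⟨P + X * P', ?_, ?_, fun τ => ?_⟩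
    · refine natDegree_add_le_of_degree_le (hP.trans n.le_succ) ?_
      refine natDegree_mul_le.trans ?_
      have := natDegree_X_le (R := ℝ)
      omega
    · rw [coeff_add, coeff_X_mul, hc, coeff_eq_zero_of_natDegree_lt (by omega), zero_add]
      rfl
    · simp [hP', he, h1]

/-- `(d/dz + q + τ k)^n u` is a polynomial in `τ` with leading coefficient `k^n u`. -/
theorem exists_polynomial_iterate_opc {q κ u : ℝ → ℝ} {z : ℝ} (hq : ContDiffAt ℝ ∞ q z)
    (hκ : ContDiffAt ℝ ∞ κ z) (hu : ContDiffAt ℝ ∞ u z) (n : ℕ) :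
    ∃ P : ℝ[X], P.natDegree ≤ n ∧ P.coeff n = κ z ^ n * u z ∧
      ∀ τ : ℝ, P.eval τ = (opc (q + τ • κ))^[n] u z := by
  let M := {f : ℝ → ℝ // ContDiffAt ℝ ∞ f z}
  let A : M → M := fun f => ⟨opc q f.1, smoothAt_opc hq f.2⟩
  let B : M → M := fun f => ⟨κ * f.1, hκ.mul f.2⟩
  obtain ⟨P, h1, h2, h3⟩ := exists_polynomial_of_recursion (A := A) (B := B)
    (E := fun τ n f => (opc (q + τ • κ))^[n] f.1 z) (e := fun f => f.1 z) (fun _ _ => rfl) (by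
      intro τ n f
      have s : ContDiffAt ℝ ∞ (q + τ • κ) z := hq.add (hκ.const_smul τ)
      have e : opc (q + τ • κ) f.1 = opc q f.1 + τ • (κ * f.1) := by
        funext x; simp [opc]; ring
      have e' := (iterate_opc_add s n (smoothAt_opc hq f.2)
        ((hκ.mul f.2).const_smul τ)).eq_of_nhds
      rw [Function.iterate_succ_apply, e]
      refine e'.trans ?_
      rw [Pi.add_apply]
      congr 1
      exact congrFun (iterate_opc_smul (q + τ • κ) τ n (κ * f.1)) z) n ⟨u, hu⟩
  refine ⟨P, h1, h2.trans ?_, h3⟩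
  have : ∀ n, ∀ f : M, (B^[n] f).1 z = κ z ^ n * f.1 z := by
    intro n
    induction n with
    | zero => intro f; simp
    | succ n ih => intro f; rw [Function.iterate_succ_apply, ih]; simp [B]; ring
  exact this n ⟨u, hu⟩

theorem exists_polynomial_curve {Q a : ℝ × ℝ → ℝ} {p : ℝ × ℝ} (hQ : ContDiffAt ℝ ∞ Q p)
    (ha : ContDiffAt ℝ ∞ a p) (n : ℕ) :
    ∃ P : ℝ[X], P.natDegree ≤ n ∧ ∀ τ : ℝ, P.eval τ =
      (opc fun x => Q (x, p.2 + τ * (x - p.1)))^[n] (fun x => a (x, p.2 + τ * (x - p.1))) p.1 := by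
  let M := {f : ℝ × ℝ → ℝ // ContDiffAt ℝ ∞ f p}
  let A : M → M := fun f => ⟨pdz f.1 + Q * f.1, (smoothAt_pdz f.2).add (hQ.mul f.2)⟩
  let B : M → M := fun f => ⟨pdw f.1, smoothAt_pdw f.2⟩
  have key : ∀ (τ : ℝ) (f : ℝ × ℝ → ℝ), ContDiffAt ℝ ∞ f p →
      ContDiffAt ℝ ∞ (fun x => f (x, p.2 + τ * (x - p.1))) p.1 := fun τ f hf =>
    smoothAt_curve (w := fun x => p.2 + τ * (x - p.1)) (by simpa using hf) (smoothAt_line _ _ _)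
  obtain ⟨P, h1, -, h3⟩ := exists_polynomial_of_recursion (A := A) (B := B)
    (E := fun τ n f => (opc fun x => Q (x, p.2 + τ * (x - p.1)))^[n]
      (fun x => f.1 (x, p.2 + τ * (x - p.1))) p.1) (e := fun f => f.1 p) (fun _ _ => by simp) (by
      intro τ n f
      have e : opc (fun x => Q (x, p.2 + τ * (x - p.1))) (fun x => f.1 (x, p.2 + τ * (x - p.1)))
          =ᶠ[𝓝 p.1] (fun x => (A f).1 (x, p.2 + τ * (x - p.1))) +
            τ • fun x => (B f).1 (x, p.2 + τ * (x - p.1)) := by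
        have hf : ContDiffAt ℝ ∞ f.1 (p.1, p.2 + τ * (p.1 - p.1)) := by simpa using f.2
        filter_upwards [deriv_curve_eventuallyEq hf (smoothAt_line p.1 p.2 τ)] with x hx
        rw [opc_apply, hx]
        simp only [Pi.add_apply, Pi.mul_apply, deriv_line, A, B, Pi.smul_apply, smul_eq_mul]
        ring
      have e' := ((iterate_opc_congr EventuallyEq.rfl n e).trans
        (iterate_opc_add (key τ Q hQ) n (key τ _ (A f).2)
          ((key τ _ (B f).2).const_smul τ))).eq_of_nhds
      rw [Function.iterate_succ_apply]
      refine e'.trans ?_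
      rw [Pi.add_apply]
      congr 1
      exact congrFun (iterate_opc_smul _ τ n _) p.1) n ⟨a, ha⟩
  exact ⟨P, h1, h3⟩

/-- On the pencil of lines through a point, `Ω_Q^n` is a polynomial of degree less than `n` in the
slope. -/
theorem exists_polynomial_Omega_line {Q : ℝ × ℝ → ℝ} {p : ℝ × ℝ} (hQ : ContDiffAt ℝ ∞ Q p)
    (k : ℕ) : ∃ P : ℝ[X], P.natDegree ≤ k + 1 ∧ ∀ τ : ℝ, P.eval τ =
      Omega Q (k + 2) (fun x => p.2 + τ * (x - p.1)) p.1 := by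
  have hs : ContDiffAt ℝ ∞ (fun q : ℝ × ℝ => Q q * q.2) p := hQ.mul contDiffAt_snd
  obtain ⟨P, h1, h2⟩ := exists_polynomial_curve hQ hs (k + 1)
  obtain ⟨P', h1', h2'⟩ := exists_polynomial_curve hQ hQ k
  have key : ∀ (τ : ℝ) (f : ℝ × ℝ → ℝ), ContDiffAt ℝ ∞ f p →
      ContDiffAt ℝ ∞ (fun x => f (x, p.2 + τ * (x - p.1))) p.1 := fun τ f hf =>
    smoothAt_curve (w := fun x => p.2 + τ * (x - p.1)) (by simpa using hf) (smoothAt_line _ _ _)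
  refine ⟨P + X * P', natDegree_add_le_of_degree_le h1 ?_, fun τ => ?_⟩
  · refine natDegree_mul_le.trans ?_
    have := natDegree_X_le (R := ℝ)
    omega
  · rw [eval_add, eval_mul, eval_X, h2, h2', Omega_eq_iterate]
    set q : ℝ → ℝ := fun x => Q (x, p.2 + τ * (x - p.1)) with hq
    -- The first application produces the slope as a bare constant, and `(d/dx + q) 1 = q` uses up a
    -- second application without a further `τ`: this saves one degree over the naive count.
    have e : opc q (fun x => p.2 + τ * (x - p.1)) =
        (fun x => q x * (p.2 + τ * (x - p.1))) + τ • 1 := by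
      funext x
      rw [opc_apply, deriv_line]
      simp; ring
    have e1 : opc q 1 = q := by
      funext x
      rw [opc_apply, deriv_one]; simp
    have e2 := (iterate_opc_add (key τ Q hQ) (k + 1) (key τ _ hs)
      (contDiffAt_const (c := (τ • (1 : ℝ))))).eq_of_nhds
    change _ = (opc q)^[k + 1] (opc q fun x => p.2 + τ * (x - p.1)) p.1
    rw [e]
    refine Eq.trans ?_ e2.symm
    rw [Pi.add_apply]
    congr 1
    have e3 := congrFun (iterate_opc_smul q τ (k + 1) 1) p.1
    rw [Function.iterate_succ_apply _ _ 1, e1] at e3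
    exact e3.symm

end PolynomialDependence

/-! ### Necessity: `ρ` depends on `z` alone; comparison of subleading coefficients -/

section Forward

variable {U : Set (ℝ × ℝ)} {ρ ψ : ℝ × ℝ → ℝ} {p : ℝ × ℝ} {k : ℕ}

theorem IsEquivTransf.exists_param (h : IsEquivTransf (k + 2) U ρ ψ) {F : ℝ × ℝ → ℝ}
    (hF : ContDiff ℝ ∞ F) : ∃ Q : ℝ × ℝ → ℝ, (∀ p ∈ U, p.2 ≠ 0 → ContDiffAt ℝ ∞ Q p) ∧
      TransformsEq (k + 2) ρ ψ F Q {p | p ∈ U ∧ p.2 ≠ 0} := by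
  obtain ⟨hP, hE⟩ := h
  obtain ⟨Q, hQ, hT⟩ := hE F hF.contDiffOn
  have e : {p | p ∈ U ∧ p.2 ≠ 0 ∧ IsRegularFor (k + 2) ρ ψ F p} = {p | p ∈ U ∧ p.2 ≠ 0} := by
    ext p
    refine and_congr_right fun hp => and_iff_left ?_
    exact isRegularFor_of_two_le k (hP.smoothAt_fst hp) (hP.smoothAt_snd hp) hF.contDiffAt
      (hP.jac_ne_zero hp)
  rw [e] at hQ hT
  refine ⟨Q, fun p hp hp2 => hQ.contDiffAt ?_, hT⟩
  exact (hP.isOpen.inter (isOpen_ne_fun continuous_snd continuous_const)).mem_nhds ⟨hp, hp2⟩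

/-- Extends identities to the line `w = 0`, which has empty interior: were `w` zero near `p`, its
`w`-derivative `1` would vanish. -/
theorem eq_zero_of_snd_ne_zero {f : ℝ × ℝ → ℝ} (hU : IsOpen U) (hp : p ∈ U)
    (hf : ContinuousAt f p) (h : ∀ q ∈ U, q.2 ≠ 0 → f q = 0) : f p = 0 := by
  by_contra h0
  have e : (fun q : ℝ × ℝ => q.2) =ᶠ[𝓝 p] fun _ => 0 := by
    filter_upwards [hU.mem_nhds hp, hf.eventually_ne h0] with q h1 h2
    by_contra h3
    exact h2 (h q h1 h3)
  have := pdw_congr e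
  simp [pdw, fderiv_snd] at this

open Polynomial in
-- The power `(x - ρ p)^(k + 1)` is the lowest one whose effect on `Ω` at the base point is the
-- constant `ψ p * (k + 1)!`, whatever the curve. The factor `T^(k + 3)` then has degree `k + 3` in
-- the slope if `ρ_w ≠ 0`, while the transformed side has degree at most `k + 1`.
theorem IsEquivTransf.pdw_fst_eq_zero_aux (h : IsEquivTransf (k + 2) U ρ ψ) (hp : p ∈ U)
    (hp2 : p.2 ≠ 0) (hψ0 : ψ p ≠ 0) : pdw ρ p = 0 := by
  have hP := h.1
  have hρ := hP.smoothAt_fst hp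
  have hψ := hP.smoothAt_snd hp
  obtain ⟨Q₀, sQ₀, hT₀⟩ := h.exists_param (F := fun _ => 0) contDiff_const
  obtain ⟨Q₁, sQ₁, hT₁⟩ := h.exists_param (F := fun q => (q.1 - ρ p) ^ (k + 1)) (by fun_prop)
  obtain ⟨P₀, d₀, e₀⟩ := exists_polynomial_Omega_line (sQ₀ p hp hp2) k
  obtain ⟨P₁, d₁, e₁⟩ := exists_polynomial_Omega_line (sQ₁ p hp hp2) k
  by_contra hw
  set L : ℝ[X] := C (pdw ρ p) * X + C (pdz ρ p) with hL
  have hLe : ∀ s, L.eval s = pdz ρ p + pdw ρ p * s := fun s => by simp [hL]; ring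
  have key : ∀ s : ℝ, L.eval s ≠ 0 → (C (ψ p * (k + 1).factorial) * L ^ (k + 3)).eval s
      = (C (jac ρ ψ p) * (P₁ - P₀)).eval s := by
    intro s hs
    rw [hLe] at hs
    obtain ⟨y, hc⟩ := exists_line_curveMapsTo hρ hψ hs
    have ep : (p.1, p.2 + s * (p.1 - p.1)) = p := by simp
    have i₀ := hT₀.mul_Omega_eq (by rw [ep]; exact ⟨hp, hp2⟩) (by rwa [ep]) (by rwa [ep])
      contDiffAt_const (by rw [ep]; exact sQ₀ p hp hp2) hc
    have i₁ := hT₁.mul_Omega_eq (by rw [ep]; exact ⟨hp, hp2⟩) (by rwa [ep]) (by rwa [ep])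
      (ContDiff.contDiffAt (by fun_prop)) (by rw [ep]; exact sQ₁ p hp hp2) hc
    rw [deriv_line, ep, ← e₀] at i₀
    rw [deriv_line, ep, ← e₁] at i₁
    have sy : ContDiffAt ℝ ∞ y (ρ p) := by simpa using hc.smooth_y
    have ey : y (ρ p) = ψ p := by simpa using hc.eventually_eq.self_of_nhds
    have i₂ := iterate_opc_add_sub (z := ρ p) (k := k) (q := 0) (g := y) (e := 0)
      (η := fun x => 1 * (x - ρ p) ^ (k + 1)) contDiffAt_const (by fun_prop) sy
      contDiffAt_const (lead_pow (ρ p) 1 (k + 1)) (Lead.zero _ _)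
    rw [ey, add_zero, zero_add] at i₂
    have i₃ : Omega (fun q => (q.1 - ρ p) ^ (k + 1)) (k + 2) y (ρ p)
        - Omega (fun _ => 0) (k + 2) y (ρ p) = ψ p * (k + 1).factorial := by
      rw [Omega_eq_iterate, Omega_eq_iterate]
      simp only [one_mul] at i₂
      refine i₂.trans ?_
      ring
    rw [eval_mul, eval_mul, eval_C, eval_C, eval_pow, hLe, eval_sub, ← i₃]
    linear_combination i₁ - i₀
  have hinf : {s : ℝ | (C (ψ p * (k + 1).factorial) * L ^ (k + 3)).eval s
      = (C (jac ρ ψ p) * (P₁ - P₀)).eval s}.Infinite := by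
    refine Set.Infinite.mono (s := {-(pdz ρ p) / pdw ρ p}ᶜ) ?_
      (Set.Finite.infinite_compl (Set.finite_singleton _))
    intro s hs
    refine key s fun h0 => hs ?_
    rw [hLe] at h0
    rw [Set.mem_singleton_iff, eq_div_iff hw]
    linear_combination h0
  have heq := congrArg (fun P => P.coeff (k + 3)) (eq_of_infinite_eval_eq _ _ hinf)
  have hcoef : (L ^ (k + 3)).coeff (k + 3) = pdw ρ p ^ (k + 3) := by
    have := coeff_pow_of_natDegree_le (p := L) (n := 1) (m := k + 3) (natDegree_linear_le)
    rw [mul_one] at this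
    rw [this]
    simp [hL]
  simp only [coeff_C_mul, hcoef, coeff_sub] at heq
  rw [coeff_eq_zero_of_natDegree_lt (by omega : P₁.natDegree < k + 3),
    coeff_eq_zero_of_natDegree_lt (by omega : P₀.natDegree < k + 3), sub_zero, mul_zero] at heq
  refine mul_ne_zero (mul_ne_zero hψ0 ?_) (pow_ne_zero _ hw) heq
  exact_mod_cast Nat.factorial_ne_zero _

theorem IsEquivTransf.pdw_fst_eq_zero (h : IsEquivTransf (k + 2) U ρ ψ) (hp : p ∈ U) :
    pdw ρ p = 0 := by
  have hP := h.1
  refine eq_zero_of_snd_ne_zero hP.isOpen hp (smoothAt_pdw (hP.smoothAt_fst hp)).continuousAt ?_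
  intro q hq hq2
  by_contra h0
  -- If `ρ_w` is nonzero near `q`, the previous lemma forces `ψ = 0` there, against the nonzero
  -- Jacobian.
  have e : ψ =ᶠ[𝓝 q] fun _ => 0 := by
    filter_upwards [hP.isOpen.mem_nhds hq, continuous_snd.continuousAt.eventually_ne hq2,
      (smoothAt_pdw (hP.smoothAt_fst hq)).continuousAt.eventually_ne h0] with r h1 h2 h3
    by_contra h4
    exact h3 (h.pdw_fst_eq_zero_aux h1 h2 h4)
  have e1 : pdz ψ q = 0 := by rw [pdz_congr e]; simp [pdz]
  have e2 : pdw ψ q = 0 := by rw [pdw_congr e]; simp [pdw]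
  exact hP.jac_ne_zero hq (by rw [jac, e1, e2]; ring)

/-- A function with vanishing `w`-derivative on a set with connected slices depends on `z` only. -/
theorem exists_eq_comp_fst {f : ℝ × ℝ → ℝ} (hU : IsOpen U)
    (hc : ∀ z : ℝ, IsPreconnected {w : ℝ | (z, w) ∈ U})
    (hf : ∀ p ∈ U, ContDiffAt ℝ ∞ f p) (h0 : ∀ p ∈ U, pdw f p = 0) :
    ∃ m : ℝ → ℝ, ∀ p ∈ U, f p = m p.1 ∧ ContDiffAt ℝ ∞ m p.1 := by
  classical
  have hs : ∀ z, IsOpen {w : ℝ | (z, w) ∈ U} := fun z => hU.preimage (by fun_prop)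
  have hd : ∀ p ∈ U, HasDerivAt (fun w => f (p.1, w)) 0 p.2 := by
    intro p hp
    have h1 : HasDerivAt (fun w : ℝ => (p.1, w)) (0, 1) p.2 :=
      (hasDerivAt_const _ _).prodMk (hasDerivAt_id _)
    have h2 := (differentiableAt_of_smoothAt (hf p hp)).hasFDerivAt.comp_hasDerivAt_of_eq
      p.2 h1 rfl
    have h3 := h0 p hp
    rw [pdw] at h3
    rwa [h3] at h2
  have key : ∀ z w w', (z, w) ∈ U → (z, w') ∈ U → f (z, w) = f (z, w') := by
    intro z w w' h1 h2
    exact (hs z).is_const_of_deriv_eq_zero (f := fun w => f (z, w)) (hc z)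
      (fun x hx => (hd _ hx).differentiableAt.differentiableWithinAt)
      (fun x hx => (hd _ hx).deriv) h1 h2
  refine ⟨fun z => if h : ∃ w, (z, w) ∈ U then f (z, h.choose) else 0, ?_⟩
  have e : ∀ p ∈ U, f p = if h : ∃ w, (p.1, w) ∈ U then f (p.1, h.choose) else 0 := by
    intro p hp
    have h : ∃ w, (p.1, w) ∈ U := ⟨p.2, hp⟩
    rw [dif_pos h]
    exact key p.1 p.2 _ hp h.choose_spec
  refine fun p hp => ⟨e p hp, ?_⟩
  -- The function defined by choice agrees near `p.1` with the restriction of `f` to a horizontal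
  -- line, so it is smooth.
  have h1 : ContDiffAt ℝ ∞ (fun z => f (z, p.2)) p.1 :=
    smoothAt_curve (w := fun _ => p.2) (hf p hp) contDiffAt_const
  refine h1.congr_of_eventuallyEq ?_
  have h2 : ∀ᶠ z in 𝓝 p.1, (z, p.2) ∈ U :=
    (Continuous.continuousAt (by fun_prop : Continuous fun z : ℝ => (z, p.2))) (hU.mem_nhds hp)
  filter_upwards [h2] with z hz using (e _ hz).symm

variable {m : ℝ → ℝ}

theorem IsPointTransf.deriv_ne_zero_of_eq_comp_fst (hP : IsPointTransf U ρ ψ)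
    (hm : ∀ p ∈ U, ρ p = m p.1 ∧ ContDiffAt ℝ ∞ m p.1) (hp : p ∈ U) :
    pdz ρ p = deriv m p.1 ∧ pdw ρ p = 0 ∧ deriv m p.1 ≠ 0 ∧ pdw ψ p ≠ 0 := by
  have e : ρ =ᶠ[𝓝 p] fun q => m q.1 := by
    filter_upwards [hP.isOpen.mem_nhds hp] with q hq using (hm q hq).1
  have h1 : pdz ρ p = deriv m p.1 := by
    rw [pdz_congr e, pdz_comp_fst (differentiableAt_of_smoothAt (hm p hp).2)]
  have h2 : pdw ρ p = 0 := by
    rw [pdw_congr e, pdw_comp_fst (differentiableAt_of_smoothAt (hm p hp).2)]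
  have h3 := hP.jac_ne_zero hp
  rw [jac, h1, h2, zero_mul, sub_zero] at h3
  exact ⟨h1, h2, left_ne_zero_of_mul h3, right_ne_zero_of_mul h3⟩

/-- Proportionality of corresponding equations when `ρ = m(z)`. -/
theorem TransformsEq.mul_Omega_eq_of_eq_comp_fst {F Q : ℝ × ℝ → ℝ} {S : Set (ℝ × ℝ)}
    {w y : ℝ → ℝ} {z : ℝ} (hP : IsPointTransf U ρ ψ)
    (hm : ∀ p ∈ U, ρ p = m p.1 ∧ ContDiffAt ℝ ∞ m p.1)
    (hT : TransformsEq (k + 2) ρ ψ F Q S) (hF : ContDiff ℝ ∞ F) (hp : (z, w z) ∈ U)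
    (hS : (z, w z) ∈ S) (hQ : ContDiffAt ℝ ∞ Q (z, w z)) (h : CurveMapsTo ρ ψ w y z) :
    deriv m z ^ (k + 2) * Omega F (k + 2) y (m z) = pdw ψ (z, w z) * Omega Q (k + 2) w z := by
  have e := hT.mul_Omega_eq hS (hP.smoothAt_fst hp) (hP.smoothAt_snd hp) hF.contDiffAt hQ h
  obtain ⟨h1, h2, h3, -⟩ := hP.deriv_ne_zero_of_eq_comp_fst hm hp
  rw [jac, h2, h1, (hm _ hp).1] at e
  simp only [zero_mul, sub_zero, add_zero] at e
  refine mul_left_cancel₀ h3 ?_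
  linear_combination e

theorem exists_curveMapsTo_of_eq_comp_fst {w : ℝ → ℝ} {z : ℝ} (hP : IsPointTransf U ρ ψ)
    (hm : ∀ p ∈ U, ρ p = m p.1 ∧ ContDiffAt ℝ ∞ m p.1) (hp : (z, w z) ∈ U)
    (hw : ContDiffAt ℝ ∞ w z) : ∃ y, CurveMapsTo ρ ψ w y z := by
  obtain ⟨h1, h2, h3, -⟩ := hP.deriv_ne_zero_of_eq_comp_fst hm hp
  refine exists_curveMapsTo (hP.smoothAt_fst hp) (hP.smoothAt_snd hp) hw ?_
  simpa [h1, h2] using h3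

theorem curve_eventually_mem {w : ℝ → ℝ} {z : ℝ} (hU : IsOpen U) (hp : (z, w z) ∈ U)
    (hw : ContinuousAt w z) : ∀ᶠ x in 𝓝 z, (x, w x) ∈ U :=
  (continuousAt_id.prodMk hw : ContinuousAt (fun x => (x, w x)) z) (hU.mem_nhds hp)

theorem CurveMapsTo.comp_eventuallyEq {w y : ℝ → ℝ} {z : ℝ} (h : CurveMapsTo ρ ψ w y z)
    (hU : IsOpen U) (hm : ∀ p ∈ U, ρ p = m p.1 ∧ ContDiffAt ℝ ∞ m p.1) (hp : (z, w z) ∈ U) :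
    y ∘ m =ᶠ[𝓝 z] fun x => ψ (x, w x) := by
  filter_upwards [h.eventually_eq, curve_eventually_mem hU hp h.smooth_w.continuousAt]
    with x h1 h2
  rw [← h1, (hm _ h2).1]; rfl

/-- Comparison of the coefficients of `w^(n-1)` in corresponding equations, for constant `F`. -/
theorem TransformsEq.compare_subleading {c : ℝ} {Q : ℝ × ℝ → ℝ} (hP : IsPointTransf U ρ ψ)
    (hm : ∀ p ∈ U, ρ p = m p.1 ∧ ContDiffAt ℝ ∞ m p.1)
    (hT : TransformsEq (k + 2) ρ ψ (fun _ => c) Q {p | p ∈ U ∧ p.2 ≠ 0}) (hp : p ∈ U)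
    (hp2 : p.2 ≠ 0) (hQ : ContDiffAt ℝ ∞ Q p) (s : ℝ) :
    (pdw (pdz ψ) p + pdw (pdw ψ) p * s)
        + (k + 1) * (pdz (pdw ψ) p + pdw (pdw ψ) p * s)
        + (if k = 0 then pdw (pdw ψ) p else 0)
        + ((k + 2) * c * deriv m p.1
          - (k + 1) * (k + 2) / 2 * (deriv (deriv m) p.1 / deriv m p.1)) * pdw ψ p
      = pdw ψ p * ((k + 2) * Q p + p.2 * pdw Q p) := by
  set z := p.1 with hz
  set w : ℝ → ℝ := fun x => p.2 + s * (x - z) with hw_def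
  have hw : ContDiffAt ℝ ∞ w z := smoothAt_line _ _ _
  have ew : (z, w z) = p := by simp [hw_def, hz]
  have ew2 : w z = p.2 := by simp [hw_def]
  have dw : deriv w z = s := deriv_line _ _ _ _
  set δ : ℝ → ℝ := fun x => ((k + 1).factorial : ℝ)⁻¹ * (x - z) ^ (k + 1) with hδ_def
  have hδ : ContDiffAt ℝ ∞ δ z := by simp only [hδ_def]; fun_prop
  -- The perturbation raises `w^(n-1)` by one and leaves the lower derivatives and `w^(n)` unchanged
  -- at `z`.
  have L : Lead z (k + 1) 1 0 δ := (lead_pow z _ _).cast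
    (inv_mul_cancel₀ (by exact_mod_cast Nat.factorial_ne_zero _)) rfl
  have δ0 : δ z = 0 := L.1
  have ew' : (z, w z + δ z) = p := by rw [δ0, add_zero, ew]
  obtain ⟨h1, h2, h3, h4⟩ := hP.deriv_ne_zero_of_eq_comp_fst hm hp
  have hmz := (hm p hp).2
  obtain ⟨y, hc⟩ := exists_curveMapsTo_of_eq_comp_fst (w := w) (z := z) hP hm (by rwa [ew]) hw
  obtain ⟨y', hc'⟩ := exists_curveMapsTo_of_eq_comp_fst (w := fun x => w x + δ x) (z := z)
    hP hm (by rwa [ew']) (hw.add hδ)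
  have i := hT.mul_Omega_eq_of_eq_comp_fst hP hm contDiff_const (by rwa [ew])
    (by rw [ew]; exact ⟨hp, hp2⟩) (by rwa [ew]) hc
  have i' := hT.mul_Omega_eq_of_eq_comp_fst (w := fun x => w x + δ x) hP hm contDiff_const
    (by rwa [ew']) (by rw [ew']; exact ⟨hp, hp2⟩) (by rwa [ew']) hc'
  rw [ew'] at i'
  have j := Omega_add_sub (F := Q) (by rwa [ew]) hw hδ L
  rw [ew] at i j
  rw [ew2] at j
  have sy : ContDiffAt ℝ ∞ y (m z) := by
    have := hc.smooth_y; rwa [ew, (hm p hp).1] at this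
  have sy' : ContDiffAt ℝ ∞ y' (m z) := by
    have := hc'.smooth_y; rwa [ew', (hm p hp).1] at this
  have L2 := (lead_incr (f := ψ) hw hδ k (by rw [ew]; exact hP.smoothAt_snd hp) L).congr
    (g := (y' - y) ∘ m) (by
      filter_upwards [hc.comp_eventuallyEq hP.isOpen hm (by rwa [ew]),
        hc'.comp_eventuallyEq hP.isOpen hm (by rwa [ew'])] with x e1 e2
      simp only [Function.comp] at e1 e2
      simp [incr, e1, e2])
  obtain ⟨A, B, L3⟩ := L2.exists_of_comp (sy'.sub sy) hmz h3
  obtain ⟨u1, u2⟩ := (L3.comp (sy'.sub sy) hmz h3).unique L2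
  have j' := Omega_add_sub (F := fun _ => c) (δ := y' - y) contDiffAt_const sy
    (sy'.sub sy) L3
  have e0 : (fun x => y x + (y' - y) x) = y' := by funext x; simp
  have e1 : pdw (fun _ : ℝ × ℝ => c) (m z, y (m z)) = 0 := by simp [pdw]
  rw [e0, e1, mul_zero, add_zero] at j'
  rw [ew, dw] at u2
  rw [ew] at u1
  have u3 : deriv m z ^ (k + 2) * (B + (k + 2) * c * A)
      = pdw ψ p * ((k + 2) * Q p + p.2 * pdw Q p) := by
    rw [← j']
    rw [mul_one, zero_add] at j
    rw [← j]
    linear_combination i' - i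
  rw [← u3]
  rw [mul_one] at u1
  push_cast at u2
  simp only [mul_one, one_pow, mul_zero, zero_add] at u2
  rw [← u1]
  linear_combination (-1 : ℝ) * u2

end Forward

/-! ### Necessity: `ψ` is affine in `w`, `Q` is determined for constant `F`, and `S = 0` -/

section AffineForm

variable {U : Set (ℝ × ℝ)} {ρ ψ : ℝ × ℝ → ℝ} {p : ℝ × ℝ} {k : ℕ} {m : ℝ → ℝ}

/-- In the comparison of subleading coefficients the slope `s` is free and occurs only as `(k + 2)
ψ_ww s`. -/
theorem IsEquivTransf.pdw_pdw_snd_eq_zero (h : IsEquivTransf (k + 2) U ρ ψ)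
    (hm : ∀ p ∈ U, ρ p = m p.1 ∧ ContDiffAt ℝ ∞ m p.1) (hp : p ∈ U) : pdw (pdw ψ) p = 0 := by
  have hP := h.1
  refine eq_zero_of_snd_ne_zero hP.isOpen hp
    (smoothAt_pdw (smoothAt_pdw (hP.smoothAt_snd hp))).continuousAt fun q hq hq2 => ?_
  obtain ⟨Q, sQ, hT⟩ := h.exists_param (F := fun _ => 0) contDiff_const
  have e0 := hT.compare_subleading hP hm hq hq2 (sQ q hq hq2) 0
  have e1 := hT.compare_subleading hP hm hq hq2 (sQ q hq hq2) 1
  have e2 : ((k : ℝ) + 2) * pdw (pdw ψ) q = 0 := by linear_combination e1 - e0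
  exact (mul_eq_zero.1 e2).resolve_left (by positivity)

theorem IsEquivTransf.exists_affine (h : IsEquivTransf (k + 2) U ρ ψ)
    (hc : ∀ z : ℝ, IsPreconnected {w : ℝ | (z, w) ∈ U})
    (hm : ∀ p ∈ U, ρ p = m p.1 ∧ ContDiffAt ℝ ∞ m p.1) :
    ∃ R S : ℝ → ℝ, ∀ p ∈ U, ψ p = R p.1 * p.2 + S p.1 ∧ ContDiffAt ℝ ∞ R p.1 ∧
      ContDiffAt ℝ ∞ S p.1 ∧ R p.1 ≠ 0 := by
  have hP := h.1
  obtain ⟨R, hR⟩ := exists_eq_comp_fst hP.isOpen hc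
    (fun p hp => smoothAt_pdw (hP.smoothAt_snd hp)) fun p hp => h.pdw_pdw_snd_eq_zero hm hp
  have sRw : ∀ p ∈ U, ContDiffAt ℝ ∞ (fun q : ℝ × ℝ => R q.1 * q.2) p := fun p hp =>
    (ContDiffAt.comp p (hR p hp).2 contDiffAt_fst).mul contDiffAt_snd
  obtain ⟨S, hS⟩ := exists_eq_comp_fst (f := ψ - fun q => R q.1 * q.2) hP.isOpen hc
    (fun p hp => (hP.smoothAt_snd hp).sub (sRw p hp)) (fun p hp => by
      have e : pdw (fun q : ℝ × ℝ => R q.1 * q.2) p = R p.1 := by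
        have := pdw_affine (p := p) (differentiableAt_of_smoothAt (hR p hp).2)
          (differentiableAt_const (0 : ℝ))
        simpa using this
      rw [pdw] at e ⊢
      rw [fderiv_sub (differentiableAt_of_smoothAt (hP.smoothAt_snd hp))
        (differentiableAt_of_smoothAt (sRw p hp)), sub_apply, e,
        ← (hR p hp).1]
      exact sub_self _)
  refine ⟨R, S, fun p hp => ⟨?_, (hR p hp).2, (hS p hp).2, ?_⟩⟩
  · rw [← (hS p hp).1, Pi.sub_apply]; ring
  · rw [← (hR p hp).1]
    exact (hP.deriv_ne_zero_of_eq_comp_fst hm hp).2.2.2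

variable {R S : ℝ → ℝ}

/-- The parameter function forced by the comparison of subleading coefficients for `F = c`. -/
def constParam (k : ℕ) (c : ℝ) (m R : ℝ → ℝ) (z : ℝ) : ℝ :=
  deriv R z / R z + c * deriv m z - (k + 1) / 2 * (deriv (deriv m) z / deriv m z)

theorem smoothAt_constParam {z : ℝ} (c : ℝ) (hm : ContDiffAt ℝ ∞ m z) (hR : ContDiffAt ℝ ∞ R z)
    (hm0 : deriv m z ≠ 0) (hR0 : R z ≠ 0) : ContDiffAt ℝ ∞ (constParam k c m R) z :=
  (((smoothAt_deriv hR).div hR hR0).add (contDiffAt_const.mul (smoothAt_deriv hm))).sub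
    (contDiffAt_const.mul ((smoothAt_deriv (smoothAt_deriv hm)).div (smoothAt_deriv hm) hm0))

theorem TransformsEq.euler_eq {c : ℝ} {Q : ℝ × ℝ → ℝ} (hP : IsPointTransf U ρ ψ)
    (hm : ∀ p ∈ U, ρ p = m p.1 ∧ ContDiffAt ℝ ∞ m p.1)
    (hψ : ∀ p ∈ U, ψ p = R p.1 * p.2 + S p.1 ∧ ContDiffAt ℝ ∞ R p.1 ∧
      ContDiffAt ℝ ∞ S p.1 ∧ R p.1 ≠ 0)
    (hT : TransformsEq (k + 2) ρ ψ (fun _ => c) Q {p | p ∈ U ∧ p.2 ≠ 0}) (hp : p ∈ U)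
    (hp2 : p.2 ≠ 0) (hQ : ContDiffAt ℝ ∞ Q p) :
    (k + 2) * Q p + p.2 * pdw Q p = (k + 2) * constParam k c m R p.1 := by
  have e := hT.compare_subleading hP hm hp hp2 hQ 0
  have e1 := hT.compare_subleading hP hm hp hp2 hQ 1
  have hww : ((k : ℝ) + 2) * pdw (pdw ψ) p = 0 := by linear_combination e1 - e
  have hww : pdw (pdw ψ) p = 0 := (mul_eq_zero.1 hww).resolve_left (by positivity)
  have eψ : ∀ q ∈ U, ψ =ᶠ[𝓝 q] fun q => R q.1 * q.2 + S q.1 := fun q hq => by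
    filter_upwards [hP.isOpen.mem_nhds hq] with r hr using (hψ r hr).1
  have dR : ∀ q ∈ U, DifferentiableAt ℝ R q.1 := fun q hq =>
    differentiableAt_of_smoothAt (hψ q hq).2.1
  have dS : ∀ q ∈ U, DifferentiableAt ℝ S q.1 := fun q hq =>
    differentiableAt_of_smoothAt (hψ q hq).2.2.1
  have ez : pdz ψ =ᶠ[𝓝 p] fun q => deriv R q.1 * q.2 + deriv S q.1 := by
    filter_upwards [hP.isOpen.mem_nhds hp] with q hq
    rw [pdz_congr (eψ q hq), pdz_affine (dR q hq) (dS q hq)]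
  have ew : pdw ψ =ᶠ[𝓝 p] fun q => R q.1 := by
    filter_upwards [hP.isOpen.mem_nhds hp] with q hq
    rw [pdw_congr (eψ q hq), pdw_affine (dR q hq) (dS q hq)]
  obtain ⟨-, sR, sS, R0⟩ := hψ p hp
  have e2 : pdw (pdz ψ) p = deriv R p.1 := by
    rw [pdw_congr ez, pdw_affine (differentiableAt_of_smoothAt (smoothAt_deriv sR))
      (differentiableAt_of_smoothAt (smoothAt_deriv sS))]
  have e3 : pdz (pdw ψ) p = deriv R p.1 := by
    rw [pdz_congr ew, pdz_comp_fst (dR p hp)]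
  rw [e2, e3, hww, ew.eq_of_nhds] at e
  simp only [ite_self, mul_zero, add_zero] at e
  refine mul_left_cancel₀ R0 ?_
  rw [← e, constParam]
  generalize deriv (deriv m) p.1 / deriv m p.1 = D
  field_simp
  ring

theorem curveMapsTo_of_affine {w y : ℝ → ℝ} {z : ℝ} (hP : IsPointTransf U ρ ψ)
    (hm : ∀ p ∈ U, ρ p = m p.1 ∧ ContDiffAt ℝ ∞ m p.1)
    (hψ : ∀ p ∈ U, ψ p = R p.1 * p.2 + S p.1 ∧ ContDiffAt ℝ ∞ R p.1 ∧
      ContDiffAt ℝ ∞ S p.1 ∧ R p.1 ≠ 0) (hp : (z, w z) ∈ U) (hw : ContDiffAt ℝ ∞ w z)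
    (hy : ContDiffAt ℝ ∞ y (m z)) (h : y ∘ m =ᶠ[𝓝 z] R * w + S) : CurveMapsTo ρ ψ w y z where
  smooth_w := hw
  smooth_y := by rwa [(hm _ hp).1]
  transversal := by
    obtain ⟨h1, h2, h3, -⟩ := hP.deriv_ne_zero_of_eq_comp_fst hm hp
    rw [deriv_curve (differentiableAt_of_smoothAt (hP.smoothAt_fst hp))
      (differentiableAt_of_smoothAt hw), h1, h2]
    simpa using h3
  eventually_eq := by
    filter_upwards [h, curve_eventually_mem hP.isOpen hp hw.continuousAt] with x h1 h2
    rw [(hm _ h2).1, (hψ _ h2).1]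
    exact h1

theorem exists_box (hU : IsOpen U) (hp : p ∈ U) (hp2 : p.2 ≠ 0) :
    ∃ ε > 0, ∀ z ∈ Metric.ball p.1 ε, ∀ w ∈ Metric.ball p.2 ε, (z, w) ∈ U ∧ w ≠ 0 := by
  have ho : IsOpen (U ∩ {q : ℝ × ℝ | q.2 ≠ 0}) :=
    hU.inter (isOpen_ne_fun continuous_snd continuous_const)
  obtain ⟨ε, hε, h⟩ := Metric.isOpen_iff.1 ho p ⟨hp, hp2⟩
  refine ⟨ε, hε, fun z hz w hw => h ?_⟩
  rw [← ball_prod_same]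
  exact ⟨hz, hw⟩

/-- Solution of the Euler equation `n Q + w Q_w = n q(z)` on a box. -/
theorem euler_solution {Q : ℝ × ℝ → ℝ} {q : ℝ → ℝ} {ε : ℝ} {z w₀ : ℝ} {n : ℕ}
    (hQ : ∀ w ∈ Metric.ball w₀ ε, DifferentiableAt ℝ Q (z, w))
    (he : ∀ w ∈ Metric.ball w₀ ε, (n + 1) * Q (z, w) + w * pdw Q (z, w) = (n + 1) * q z)
    {w : ℝ} (hw : w ∈ Metric.ball w₀ ε) :
    w ^ (n + 1) * (Q (z, w) - q z) = w₀ ^ (n + 1) * (Q (z, w₀) - q z) := by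
  have hd : ∀ x ∈ Metric.ball w₀ ε, HasDerivAt (fun w => w ^ (n + 1) * (Q (z, w) - q z)) 0 x := by
    intro x hx
    have h1 : HasDerivAt (fun w : ℝ => (z, w)) (0, 1) x :=
      (hasDerivAt_const _ _).prodMk (hasDerivAt_id _)
    have h2 : HasDerivAt (fun w => Q (z, w)) (pdw Q (z, x)) x :=
      (hQ x hx).hasFDerivAt.comp_hasDerivAt_of_eq x h1 rfl
    refine ((hasDerivAt_pow (n + 1) x).mul (h2.sub_const (q z))).congr_deriv ?_
    push_cast
    linear_combination x ^ n * he x hx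
  have hpos : 0 < ε := Metric.pos_of_mem_ball hw
  exact Metric.isOpen_ball.is_const_of_deriv_eq_zero
    (f := fun w => w ^ (n + 1) * (Q (z, w) - q z))
    (convex_ball w₀ ε).isPreconnected
    (fun x hx => (hd x hx).differentiableAt.differentiableWithinAt)
    (fun x hx => (hd x hx).deriv) hw (Metric.mem_ball_self hpos)

open Polynomial in
/-- If `a P(t^n) = b + d t` for infinitely many `t`, where `P` has degree at most `n ≥ 2`, then the
leading coefficient of `P` and `d` vanish. -/
theorem coeff_eq_zero_of_expand {P : ℝ[X]} {n : ℕ} (hn : 2 ≤ n) {a b d : ℝ} (ha : a ≠ 0)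
    {T : Set ℝ} (hT : T.Infinite) (h : ∀ t ∈ T, a * P.eval (t ^ n) = b + d * t) :
    P.coeff n = 0 ∧ d = 0 := by
  have e : C a * expand ℝ n P = C b + C d * X := by
    refine eq_of_infinite_eval_eq _ _ (hT.mono fun t ht => ?_)
    simp only [Set.mem_ofPred_eq, eval_mul, eval_C, expand_eval, eval_add, eval_X]
    exact h t ht
  have h1 : 1 < n := hn
  have hnn : 1 < n * n := lt_of_lt_of_le h1 (Nat.le_mul_self n)
  constructor
  · have := congrArg (fun P => P.coeff (n * n)) e
    simp only [coeff_C_mul, coeff_expand_mul (by omega : 0 < n), coeff_add, coeff_C, coeff_X]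
      at this
    rw [if_neg (by omega), if_neg (by omega), mul_zero, add_zero] at this
    exact (mul_eq_zero.1 this).resolve_left ha
  · have := congrArg (fun P => P.coeff 1) e
    simp only [coeff_C_mul, coeff_expand (by omega : 0 < n), coeff_add, coeff_C, coeff_X] at this
    rw [if_neg (by simp; omega)] at this
    simpa using this.symm

/-- The Euler equation leaves a term `κ(z) w^(-n)` in `Q`. On `w = const`, `Ω_Q[w] / w` is a
polynomial in `w^(-n)` with leading coefficient `κ^n`, whereas the other side divided by `w` is
affine in `1 / w`. As `n ≥ 2`, both the top coefficient and the coefficient of `1 / w` vanish. -/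
theorem TransformsEq.param_eq {c : ℝ} {Q : ℝ × ℝ → ℝ} (hP : IsPointTransf U ρ ψ)
    (hm : ∀ p ∈ U, ρ p = m p.1 ∧ ContDiffAt ℝ ∞ m p.1)
    (hψ : ∀ p ∈ U, ψ p = R p.1 * p.2 + S p.1 ∧ ContDiffAt ℝ ∞ R p.1 ∧
      ContDiffAt ℝ ∞ S p.1 ∧ R p.1 ≠ 0)
    (hT : TransformsEq (k + 2) ρ ψ (fun _ => c) Q {p | p ∈ U ∧ p.2 ≠ 0})
    (hQ : ∀ p ∈ U, p.2 ≠ 0 → ContDiffAt ℝ ∞ Q p) (hp : p ∈ U) (hp2 : p.2 ≠ 0) {σ : ℝ → ℝ}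
    (hσ : ContDiffAt ℝ ∞ σ (m p.1)) (hσS : σ ∘ m =ᶠ[𝓝 p.1] S) :
    Q p = constParam k c m R p.1 ∧ (opc fun _ => c)^[k + 2] σ (m p.1) = 0 := by
  obtain ⟨ε, hε, hbox⟩ := exists_box hP.isOpen hp hp2
  obtain ⟨-, -, hm0, -⟩ := hP.deriv_ne_zero_of_eq_comp_fst hm hp
  obtain ⟨-, sR, sS, R0⟩ := hψ p hp
  have sm := (hm p hp).2
  set q := constParam k c m R with hq
  have sq : ContDiffAt ℝ ∞ q p.1 := smoothAt_constParam c sm sR hm0 R0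
  -- The first integral `w^n (Q - q)` of the Euler equation, evaluated at `w = p.2`.
  set κ : ℝ → ℝ := fun z => p.2 ^ (k + 2) * (Q (z, p.2) - q z) with hκ
  have sκ : ContDiffAt ℝ ∞ κ p.1 := contDiffAt_const.mul
    ((smoothAt_curve (w := fun _ => p.2) (hQ p hp hp2) contDiffAt_const).sub sq)
  have key : ∀ z ∈ Metric.ball p.1 ε, ∀ w ∈ Metric.ball p.2 ε,
      Q (z, w) = q z + (w⁻¹) ^ (k + 2) * κ z := by
    intro z hz w hw
    have e := euler_solution (Q := Q) (q := q) (n := k + 1) (z := z)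
      (fun w hw => differentiableAt_of_smoothAt (hQ _ (hbox z hz w hw).1 (hbox z hz w hw).2))
      (fun w hw => by
        have := hT.euler_eq hP hm hψ (hbox z hz w hw).1 (hbox z hz w hw).2
          (hQ _ (hbox z hz w hw).1 (hbox z hz w hw).2)
        push_cast
        linear_combination this) hw
    have hw0 := (hbox z hz w hw).2
    rw [hκ]
    simp only
    rw [← e, inv_pow, inv_mul_cancel_left₀ (pow_ne_zero _ hw0)]
    ring
  obtain ⟨P, hPd, hPc, hPe⟩ := exists_polynomial_iterate_opc sq sκ
    (contDiffAt_const (c := (1 : ℝ))) (k + 2)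
  -- With `r ∘ m = R` and `σ ∘ m = S`, the image of the curve `w = const` is `y = w r + σ`.
  obtain ⟨r, sr, hr⟩ := exists_comp_eventuallyEq sm hm0 sR
  set α := (opc fun _ => c)^[k + 2] r (m p.1) with hα
  set β := (opc fun _ => c)^[k + 2] σ (m p.1) with hβ
  have main : ∀ t ∈ (fun x : ℝ => x⁻¹) '' Metric.ball p.2 ε,
      R p.1 * P.eval (t ^ (k + 2)) = deriv m p.1 ^ (k + 2) * α
        + deriv m p.1 ^ (k + 2) * β * t := by
    rintro _ ⟨w, hw, rfl⟩
    have hz : p.1 ∈ Metric.ball p.1 ε := Metric.mem_ball_self hε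
    obtain ⟨hU, hw0⟩ := hbox p.1 hz w hw
    have hc := curveMapsTo_of_affine (w := fun _ => w) (y := w • r + σ) hP hm hψ hU
      contDiffAt_const ((sr.const_smul w).add hσ) (by
        filter_upwards [hr, hσS] with x h1 h2
        simp only [Function.comp] at h1 h2
        simp [h1, h2, mul_comm])
    have e := hT.mul_Omega_eq_of_eq_comp_fst hP hm contDiff_const hU ⟨hU, hw0⟩ (hQ _ hU hw0) hc
    have e1 : Omega (fun _ => c) (k + 2) (w • r + σ) (m p.1) = w * α + β := by
      rw [Omega_eq_iterate, (iterate_opc_add (f := w • r) contDiffAt_const (k + 2)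
        (sr.const_smul w) hσ).eq_of_nhds, Pi.add_apply, iterate_opc_smul]
      rfl
    have e2 : Omega Q (k + 2) (fun _ => w) p.1 = w * P.eval (w⁻¹ ^ (k + 2)) := by
      rw [Omega_eq_iterate, hPe]
      have e3 : (fun x => Q (x, w)) =ᶠ[𝓝 p.1] q + w⁻¹ ^ (k + 2) • κ := by
        filter_upwards [Metric.ball_mem_nhds p.1 hε] with x hx using key x hx w hw
      have e4 : (fun _ : ℝ => w) = w • fun _ : ℝ => (1 : ℝ) := by funext x; simp
      rw [(iterate_opc_congr e3 (k + 2) (EventuallyEq.refl _ _)).eq_of_nhds, e4, iterate_opc_smul]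
      rfl
    have e3 : pdw ψ (p.1, w) = R p.1 := by
      have : ψ =ᶠ[𝓝 (p.1, w)] fun q => R q.1 * q.2 + S q.1 := by
        filter_upwards [hP.isOpen.mem_nhds hU] with r hr using (hψ r hr).1
      rw [pdw_congr this, pdw_affine (p := (p.1, w)) (differentiableAt_of_smoothAt sR)
        (differentiableAt_of_smoothAt sS)]
    rw [e1, e2, e3] at e
    refine mul_left_cancel₀ hw0 ?_
    linear_combination -e - deriv m p.1 ^ (k + 2) * β * mul_inv_cancel₀ hw0
  have hinf : ((fun x : ℝ => x⁻¹) '' Metric.ball p.2 ε).Infinite :=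
    Set.Infinite.image inv_injective.injOn
      (infinite_of_mem_nhds p.2 (Metric.ball_mem_nhds p.2 hε))
  obtain ⟨h1, h2⟩ := coeff_eq_zero_of_expand (by omega) R0 hinf main
  refine ⟨?_, (mul_eq_zero.1 h2).resolve_left (pow_ne_zero _ hm0)⟩
  rw [hPc, mul_one] at h1
  have h3 : p.2 ^ (k + 2) * (Q (p.1, p.2) - q p.1) = 0 :=
    eq_zero_of_pow_eq_zero (n := k + 2) h1
  exact sub_eq_zero.1 ((mul_eq_zero.1 h3).resolve_left (pow_ne_zero _ hp2))

/-- `(d/dx + c)^n σ` vanishes at the base point for every real `c`; as a polynomial in `c` its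
leading coefficient is `σ`, the value of `S`. -/
theorem IsEquivTransf.remainder_eq_zero (h : IsEquivTransf (k + 2) U ρ ψ)
    (hm : ∀ p ∈ U, ρ p = m p.1 ∧ ContDiffAt ℝ ∞ m p.1)
    (hψ : ∀ p ∈ U, ψ p = R p.1 * p.2 + S p.1 ∧ ContDiffAt ℝ ∞ R p.1 ∧
      ContDiffAt ℝ ∞ S p.1 ∧ R p.1 ≠ 0) (hp : p ∈ U) : S p.1 = 0 := by
  have hP := h.1
  refine eq_zero_of_snd_ne_zero (f := fun q => S q.1) hP.isOpen hp
    (ContinuousAt.comp (f := Prod.fst) (hψ p hp).2.2.1.continuousAt continuousAt_fst)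
    fun p hp hp2 => ?_
  obtain ⟨-, -, hm0, -⟩ := hP.deriv_ne_zero_of_eq_comp_fst hm hp
  obtain ⟨σ, sσ, hσ⟩ := exists_comp_eventuallyEq (hm p hp).2 hm0 (hψ p hp).2.2.1
  obtain ⟨P, -, hPc, hPe⟩ := exists_polynomial_iterate_opc (q := fun _ => 0) (κ := fun _ => 1)
    contDiffAt_const contDiffAt_const sσ (k + 2)
  have h0 : P = 0 := by
    refine Polynomial.eq_of_infinite_eval_eq _ _ (Set.infinite_univ.mono fun c _ => ?_)
    obtain ⟨Q, hQ, hT⟩ := h.exists_param (F := fun _ => c) contDiff_const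
    have e := (hT.param_eq hP hm hψ hQ hp hp2 sσ hσ).2
    have e' : ((fun _ : ℝ => (0 : ℝ)) + c • fun _ : ℝ => (1 : ℝ)) = fun _ => c := by
      funext x; simp
    rw [Set.mem_ofPred_eq, hPe, e', e]
    simp
  rw [h0] at hPc
  simp only [Polynomial.coeff_zero, one_pow, one_mul] at hPc
  rw [← hσ.eq_of_nhds]
  exact hPc.symm

end AffineForm

/-! ### The Schwarzian derivative and Moebius functions -/

section Schwarzian

variable {z : ℝ}

/-- The derivative of order `N + 2` of `g u^N` at a zero of `u`. -/
theorem iterate_deriv_mul_pow {u : ℝ → ℝ} (hu : ContDiffAt ℝ ∞ u z) (h0 : u z = 0)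
    (h1 : deriv u z ≠ 0) (N : ℕ) : ∀ {g : ℝ → ℝ}, ContDiffAt ℝ ∞ g z →
    (opc 0)^[N + 2] (g * u ^ N) z = (N + 2).factorial / 2 * deriv u z ^ N *
      (deriv (deriv g) z + N * deriv g z * (deriv (deriv u) z / deriv u z)
        + g z * (N / 3 * (deriv (deriv (deriv u)) z / deriv u z)
          + N * (N - 1) / 4 * (deriv (deriv u) z / deriv u z) ^ 2)) := by
  have su' := smoothAt_deriv hu
  have su'' := smoothAt_deriv su'
  induction N with
  | zero =>
    intro g _
    simp [Function.iterate_succ_apply, opc_zero]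
  | succ N ih =>
    intro g hg
    have sg' := smoothAt_deriv hg
    have sg'' := smoothAt_deriv sg'
    have sc : ContDiffAt ℝ ∞ (fun _ : ℝ => (N + 1 : ℝ)) z := contDiffAt_const
    set c : ℝ → ℝ := fun _ => (N + 1 : ℝ) with hc
    have sG : ContDiffAt ℝ ∞ (deriv g * u + c * (g * deriv u)) z :=
      (sg'.mul hu).add (sc.mul (hg.mul su'))
    -- One differentiation gives the same form with exponent `N` and a new factor, whose derivatives
    -- up to order two at the zero of `u` suffice.
    have e : opc 0 (g * u ^ (N + 1)) =ᶠ[𝓝 z] (deriv g * u + c * (g * deriv u)) * u ^ N := by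
      filter_upwards [deriv_mul_eventuallyEq (g := u ^ (N + 1)) hg (hu.pow (N + 1)),
        differentiableAt_eventually hu] with x hx hx'
      rw [opc_zero, hx]
      simp only [Pi.add_apply, Pi.mul_apply, Pi.pow_apply, deriv_pow hx', hc]
      push_cast
      ring
    have cd : deriv c = 0 := by funext x; simp [hc]
    have e1 : deriv (deriv g * u + c * (g * deriv u)) =ᶠ[𝓝 z]
        (deriv (deriv g) * u + deriv g * deriv u)
          + c * (deriv g * deriv u + g * deriv (deriv u)) := by
      filter_upwards [deriv_add_eventuallyEq (f := deriv g * u) (g := c * (g * deriv u))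
        (sg'.mul hu) (sc.mul (hg.mul su')),
        deriv_mul_eventuallyEq sg' hu, deriv_mul_eventuallyEq (g := g * deriv u) sc (hg.mul su'),
        deriv_mul_eventuallyEq hg su'] with x x1 x2 x3 x4
      simp only [Pi.add_apply, Pi.mul_apply] at x1 x2 x3 x4 ⊢
      rw [x1, x2, x3, x4, cd]
      simp
    have e2 : deriv (deriv (deriv g * u + c * (g * deriv u))) z =
        (N + 3) * deriv (deriv g) z * deriv u z + (2 * N + 3) * deriv g z * deriv (deriv u) z
          + (N + 1) * g z * deriv (deriv (deriv u)) z := by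
      rw [e1.deriv_eq, (deriv_add_eventuallyEq (f := deriv (deriv g) * u + deriv g * deriv u)
        (g := c * (deriv g * deriv u + g * deriv (deriv u)))
        ((sg''.mul hu).add (sg'.mul su'))
        (sc.mul ((sg'.mul su').add (hg.mul su'')))).eq_of_nhds, Pi.add_apply,
        (deriv_add_eventuallyEq (f := deriv (deriv g) * u) (g := deriv g * deriv u)
          (sg''.mul hu) (sg'.mul su')).eq_of_nhds, Pi.add_apply,
        (deriv_mul_eventuallyEq sg'' hu).eq_of_nhds, (deriv_mul_eventuallyEq sg' su').eq_of_nhds,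
        (deriv_mul_eventuallyEq (g := deriv g * deriv u + g * deriv (deriv u)) sc
          ((sg'.mul su').add (hg.mul su''))).eq_of_nhds]
      simp only [Pi.add_apply, Pi.mul_apply]
      rw [(deriv_add_eventuallyEq (f := deriv g * deriv u) (g := g * deriv (deriv u))
          (sg'.mul su') (hg.mul su'')).eq_of_nhds, Pi.add_apply,
        (deriv_mul_eventuallyEq sg' su').eq_of_nhds, (deriv_mul_eventuallyEq hg su'').eq_of_nhds]
      rw [cd]
      simp only [Pi.zero_apply, Pi.add_apply, Pi.mul_apply, h0, hc]
      ring
    rw [Function.iterate_succ_apply, (iterate_opc_congr EventuallyEq.rfl (N + 2) e).eq_of_nhds,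
      ih sG, e2, e1.eq_of_nhds]
    simp only [Pi.add_apply, Pi.mul_apply, h0, hc, Nat.factorial_succ (N + 2)]
    push_cast
    field_simp
    ring

variable {m : ℝ → ℝ}

/-- The power `|m'|^α` of the derivative of `m`. -/
def derivPow (m : ℝ → ℝ) (α : ℝ) (x : ℝ) : ℝ := Real.exp (α * Real.log (deriv m x))

theorem derivPow_pos (m : ℝ → ℝ) (α x : ℝ) : 0 < derivPow m α x := Real.exp_pos _

theorem smoothAt_derivPow (hm : ContDiffAt ℝ ∞ m z) (h0 : deriv m z ≠ 0) (α : ℝ) :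
    ContDiffAt ℝ ∞ (derivPow m α) z :=
  (contDiffAt_const.mul ((smoothAt_deriv hm).log h0)).exp

theorem deriv_derivPow (hm : ContDiffAt ℝ ∞ m z) (h0 : deriv m z ≠ 0) (α : ℝ) :
    deriv (derivPow m α) =ᶠ[𝓝 z] (α • (deriv (deriv m) / deriv m)) * derivPow m α := by
  filter_upwards [differentiableAt_eventually (smoothAt_deriv hm),
    (smoothAt_deriv hm).continuousAt.eventually_ne h0] with x h1 h2
  have := ((h1.hasDerivAt.log h2).const_mul α).exp
  refine Eq.trans this.deriv ?_
  simp only [Pi.mul_apply, Pi.smul_apply, Pi.div_apply, smul_eq_mul, derivPow]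
  ring

theorem smoothAt_logDeriv (hm : ContDiffAt ℝ ∞ m z) (h0 : deriv m z ≠ 0) :
    ContDiffAt ℝ ∞ (deriv (deriv m) / deriv m) z :=
  (smoothAt_deriv (smoothAt_deriv hm)).div (smoothAt_deriv hm) h0

theorem deriv_deriv_derivPow (hm : ContDiffAt ℝ ∞ m z) (h0 : deriv m z ≠ 0) (α : ℝ) :
    deriv (deriv (derivPow m α)) z = (α * deriv (deriv (deriv m) / deriv m) z
      + α ^ 2 * (deriv (deriv m) z / deriv m z) ^ 2) * derivPow m α z := by
  have sl := smoothAt_logDeriv hm h0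
  rw [(deriv_derivPow hm h0 α).deriv_eq, (deriv_mul_eventuallyEq
    (f := α • (deriv (deriv m) / deriv m)) (sl.const_smul α)
    (smoothAt_derivPow hm h0 α)).eq_of_nhds, Pi.add_apply, Pi.mul_apply, Pi.mul_apply,
    (deriv_derivPow hm h0 α).eq_of_nhds,
    deriv_const_smul α (differentiableAt_of_smoothAt sl)]
  simp only [Pi.mul_apply, Pi.smul_apply, Pi.div_apply, smul_eq_mul]
  ring

theorem deriv_deriv_deriv_eq (hm : ContDiffAt ℝ ∞ m z) (h0 : deriv m z ≠ 0) :
    deriv (deriv (deriv m)) z / deriv m z = deriv (deriv (deriv m) / deriv m) z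
      + (deriv (deriv m) z / deriv m z) ^ 2 := by
  have e : deriv (deriv m) =ᶠ[𝓝 z] (deriv (deriv m) / deriv m) * deriv m := by
    filter_upwards [(smoothAt_deriv hm).continuousAt.eventually_ne h0] with x hx
    simp only [Pi.mul_apply, Pi.div_apply]
    field_simp
  rw [e.deriv_eq, (deriv_mul_eventuallyEq (smoothAt_logDeriv hm h0)
    (smoothAt_deriv hm)).eq_of_nhds]
  simp only [Pi.add_apply, Pi.mul_apply, Pi.div_apply]
  field_simp

/-- With `l = m'' / m'`, the weight `-(N + 1) / 2` makes the terms combine to a nonzero multiple of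
the Schwarzian `l' - l² / 2`; the second derivative of `|m'|^(-1/2)` is `-1/2` times the Schwarzian
times `|m'|^(-1/2)`. -/
theorem schwarzian_eq_zero (hm : ContDiffAt ℝ ∞ m z) (h0 : deriv m z ≠ 0) (N : ℕ)
    (h : (opc 0)^[N + 2] (derivPow m (-(N + 1) / 2) * (m - fun _ => m z) ^ N) z = 0) :
    deriv (deriv (derivPow m (-1 / 2))) z = 0 := by
  set u : ℝ → ℝ := m - fun _ => m z with hu
  have su : ContDiffAt ℝ ∞ u z := hm.sub contDiffAt_const
  have du : deriv u = deriv m := by funext x; simp [hu, Pi.sub_def]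
  have e := iterate_deriv_mul_pow su (by simp [hu]) (by rwa [du]) N
    (smoothAt_derivPow hm h0 (-(N + 1) / 2))
  rw [h, du, deriv_deriv_derivPow hm h0, (deriv_derivPow hm h0 _).eq_of_nhds,
    deriv_deriv_deriv_eq hm h0] at e
  rw [deriv_deriv_derivPow hm h0]
  simp only [Pi.mul_apply, Pi.smul_apply, Pi.div_apply, smul_eq_mul] at e
  set l := deriv (deriv m) z / deriv m z
  set l' := deriv (deriv (deriv m) / deriv m) z
  set g := derivPow m (-(N + 1) / 2) z with hg
  have hg0 : g ≠ 0 := (derivPow_pos _ _ _).ne'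
  have hN : ((N : ℝ) + 3) ≠ 0 := by positivity
  have hf : ((N + 2).factorial : ℝ) ≠ 0 := by exact_mod_cast Nat.factorial_ne_zero _
  have e2 : ((N + 2).factorial / 2 * deriv m z ^ N * g * ((N + 3) / 6)) * (l' - l ^ 2 / 2) = 0 := by
    linear_combination e
  have e3 : l' - l ^ 2 / 2 = 0 := by
    refine (mul_eq_zero.1 e2).resolve_left ?_
    refine mul_ne_zero (mul_ne_zero (mul_ne_zero (div_ne_zero hf two_ne_zero)
      (pow_ne_zero _ h0)) hg0) (div_ne_zero hN (by norm_num))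
  have e4 : -1 / 2 * l' + (-1 / 2) ^ 2 * l ^ 2 = 0 := by linear_combination (-1 / 2 : ℝ) * e3
  rw [e4, zero_mul]

theorem iterate_opc_zero_pow (c x₀ : ℝ) (N : ℕ) :
    (opc 0)^[N + 1] (fun x => c * (x - x₀) ^ N) = 0 := by
  induction N generalizing c with
  | zero => funext x; simp [opc_zero]
  | succ N ih =>
    rw [Function.iterate_succ_apply, opc_zero, deriv_const_mul_sub_pow]
    exact ih _

/-- A function with vanishing Schwarzian derivative on an interval is a Moebius transformation. -/
theorem exists_mobius {I : Set ℝ} (hI : IsOpen I) (hc : IsPreconnected I) (hne : I.Nonempty)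
    (hm : ∀ z ∈ I, ContDiffAt ℝ ∞ m z) (h0 : ∀ z ∈ I, deriv m z ≠ 0)
    (hS : ∀ z ∈ I, deriv (deriv (derivPow m (-1 / 2))) z = 0) :
    ∃ k₁ k₂ k₃ k₄ : ℝ, (k₄ = 0 ∨ k₄ = 1) ∧ k₂ * k₃ - k₁ * k₄ ≠ 0 ∧
      (∀ z ∈ I, k₄ * z + k₃ ≠ 0) ∧ ∀ z ∈ I, m z = mobius k₁ k₂ k₃ k₄ z := by
  obtain ⟨z₀, hz₀⟩ := hne
  have const : ∀ f : ℝ → ℝ, (∀ z ∈ I, HasDerivAt f 0 z) → ∀ z ∈ I, f z = f z₀ := by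
    intro f hf z hz
    exact hI.is_const_of_deriv_eq_zero hc
      (fun x hx => (hf x hx).differentiableAt.differentiableWithinAt)
      (fun x hx => (hf x hx).deriv) hz hz₀
  set h := derivPow m (-1 / 2) with hh
  have sh : ∀ z ∈ I, ContDiffAt ℝ ∞ h z := fun z hz => smoothAt_derivPow (hm z hz) (h0 z hz) _
  have dh : ∀ z ∈ I, HasDerivAt h (deriv h z) z := fun z hz =>
    (differentiableAt_of_smoothAt (sh z hz)).hasDerivAt
  set a := deriv h z₀ with ha
  have h1 : ∀ z ∈ I, deriv h z = a := const (deriv h) fun z hz => by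
    have := (differentiableAt_of_smoothAt (smoothAt_deriv (sh z hz))).hasDerivAt
    rwa [hS z hz] at this
  have h2 : ∀ z ∈ I, h z - a * z = h z₀ - a * z₀ := const (fun z => h z - a * z) fun z hz => by
    have := (dh z hz).sub ((hasDerivAt_id z).const_mul a)
    rw [h1 z hz] at this
    exact this.congr_deriv (by simp)
  set b := h z₀ - a * z₀ with hb
  have hpos : ∀ z ∈ I, a * z + b ≠ 0 := fun z hz => by
    rw [← h2 z hz]
    have := (derivPow_pos m (-1 / 2) z).ne'
    rwa [add_sub_cancel]
  -- `h² = 1 / |m'|`, so the product is the sign of `m'`; with `h = a z + b` affine, `m' = ε / (a z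
  -- + b)²` can be integrated.
  have h3 : ∀ z ∈ I, deriv m z * h z ^ 2 = deriv m z₀ * h z₀ ^ 2 :=
    const (fun z => deriv m z * h z ^ 2) fun z hz => by
      have e1 := (differentiableAt_of_smoothAt (smoothAt_deriv (hm z hz))).hasDerivAt
      have e2 := e1.mul ((dh z hz).pow 2)
      refine e2.congr_deriv ?_
      rw [(deriv_derivPow (hm z hz) (h0 z hz) _).eq_of_nhds]
      simp only [Pi.mul_apply, Pi.smul_apply, Pi.div_apply, smul_eq_mul, Pi.pow_apply]
      have := h0 z hz
      rw [← hh]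
      field_simp
      push_cast
      ring
  set ε := deriv m z₀ * h z₀ ^ 2 with hε
  have hε0 : ε ≠ 0 := mul_ne_zero (h0 _ hz₀) (pow_ne_zero _ (derivPow_pos _ _ _).ne')
  have h4 : ∀ z ∈ I, HasDerivAt m (ε / (a * z + b) ^ 2) z := fun z hz => by
    have e1 := (differentiableAt_of_smoothAt (hm z hz)).hasDerivAt
    refine e1.congr_deriv ?_
    rw [eq_div_iff (pow_ne_zero _ (hpos z hz)), ← h3 z hz, ← h2 z hz]
    ring
  by_cases ha0 : a = 0
  · have hb0 : b ≠ 0 := by simpa [ha0] using hpos z₀ hz₀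
    have h5 := const (fun z => m z - ε / b ^ 2 * z) fun z hz => by
      have := (h4 z hz).sub ((hasDerivAt_id z).const_mul (ε / b ^ 2))
      refine this.congr_deriv ?_
      rw [ha0]; simp
    refine ⟨m z₀ - ε / b ^ 2 * z₀, ε / b ^ 2, 1, 0, Or.inl rfl, ?_, fun z _ => by simp, ?_⟩
    · simpa using ⟨hε0, hb0⟩
    · intro z hz
      have := h5 z hz
      simp only [mobius]
      linear_combination this
  · have h5 := const (fun z => m z + ε / a * (a * z + b)⁻¹) fun z hz => by
      have e1 : HasDerivAt (fun x => a * x + b) a z := by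
        simpa using ((hasDerivAt_id z).const_mul a).add_const b
      have := (h4 z hz).add ((e1.inv (hpos z hz)).const_mul (ε / a))
      refine this.congr_deriv ?_
      have := hpos z hz
      field_simp
      ring
    -- Integration gives `m = c - (ε / a) / (a z + b)`; dividing the denominator by `a` normalizes
    -- `k₄` to one.
    set c := m z₀ + ε / a * (a * z₀ + b)⁻¹ with hc'
    have hp : ∀ z ∈ I, 1 * z + b / a ≠ 0 := fun z hz => by
      have : 1 * z + b / a = (a * z + b) / a := by field_simp
      rw [this]
      exact div_ne_zero (hpos z hz) ha0
    refine ⟨c * (b / a) - ε / a ^ 2, c, b / a, 1, Or.inr rfl, ?_, hp, ?_⟩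
    · have : c * (b / a) - (c * (b / a) - ε / a ^ 2) * 1 = ε / a ^ 2 := by ring
      rw [this]
      exact div_ne_zero hε0 (pow_ne_zero _ ha0)
    · intro z hz
      have e1 : m z = c - ε / a * (a * z + b)⁻¹ := by rw [← h5 z hz]; ring
      rw [mobius, eq_div_iff (hp z hz), e1]
      have := hpos z hz
      field_simp
      ring

end Schwarzian

/-! ### Necessity: `ρ` is Moebius -/

section Main

variable {U : Set (ℝ × ℝ)} {ρ ψ : ℝ × ℝ → ℝ} {p : ℝ × ℝ} {k : ℕ} {m R S : ℝ → ℝ}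

theorem eq_zero_of_eventually_affine {A B : ℝ} (h : ∀ᶠ t in 𝓝 (0 : ℝ), A + t * B = 0) :
    B = 0 := by
  have h0 : A = 0 := by simpa using h.self_of_nhds
  have h1 : ∀ᶠ t in 𝓝[≠] (0 : ℝ), t * B = 0 := by
    filter_upwards [h.filter_mono nhdsWithin_le_nhds] with t ht
    rwa [h0, zero_add] at ht
  obtain ⟨t, ht, ht0⟩ := (h1.and self_mem_nhdsWithin).exists
  exact (mul_eq_zero.1 ht).resolve_left ht0

/-- For `F = 0`, polynomials in `x` of degree less than `n` are solutions. Conjugation by `R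
|m'|^(-(n-1)/2)` turns the transformed operator into `d/dz`, so the derivative of order `n` of
`|m'|^(-(n-1)/2) (y ∘ m)` vanishes. -/
theorem IsEquivTransf.schwarzian_fst_eq_zero (h : IsEquivTransf (k + 2) U ρ ψ)
    (hm : ∀ p ∈ U, ρ p = m p.1 ∧ ContDiffAt ℝ ∞ m p.1)
    (hψ : ∀ p ∈ U, ψ p = R p.1 * p.2 + S p.1 ∧ ContDiffAt ℝ ∞ R p.1 ∧
      ContDiffAt ℝ ∞ S p.1 ∧ R p.1 ≠ 0) (hp : p ∈ U) :
    deriv (deriv (derivPow m (-1 / 2))) p.1 = 0 := by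
  have hP := h.1
  have hS0 : ∀ p ∈ U, S p.1 = 0 := fun p hp => h.remainder_eq_zero hm hψ hp
  have hm0 : ∀ p ∈ U, deriv m p.1 ≠ 0 := fun p hp =>
    (hP.deriv_ne_zero_of_eq_comp_fst hm hp).2.2.1
  refine eq_zero_of_snd_ne_zero (f := fun q => deriv (deriv (derivPow m (-1 / 2))) q.1)
    hP.isOpen hp (ContinuousAt.comp (f := Prod.fst) (smoothAt_deriv (smoothAt_deriv
      (smoothAt_derivPow (hm p hp).2 (hm0 p hp) _))).continuousAt continuousAt_fst)
    fun p hp hp2 => ?_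
  obtain ⟨-, sR, sS, R0⟩ := hψ p hp
  have sm := (hm p hp).2
  have dm0 := hm0 p hp
  obtain ⟨Q, hQ, hT⟩ := h.exists_param (F := fun _ => 0) contDiff_const
  have hQq : ∀ q ∈ U, q.2 ≠ 0 → Q q = constParam k 0 m R q.1 := fun q hq hq2 => by
    obtain ⟨σ, sσ, hσ⟩ := exists_comp_eventuallyEq (hm q hq).2 (hm0 q hq) (hψ q hq).2.2.1
    exact (hT.param_eq hP hm hψ hQ hq hq2 sσ hσ).1
  refine schwarzian_eq_zero sm dm0 k ?_
  set g := derivPow m (-(k + 1) / 2) with hg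
  have sg : ContDiffAt ℝ ∞ g p.1 := smoothAt_derivPow sm dm0 _
  set u : ℝ → ℝ := m - fun _ => m p.1 with hu
  have su : ContDiffAt ℝ ∞ u p.1 := sm.sub contDiffAt_const
  -- The constant `R p.1 * p.2` added to the test solution keeps the curve near `p`, where `w ≠ 0`
  -- and `Q` is known; varying a small `t` isolates the term of interest.
  refine eq_zero_of_eventually_affine (A := R p.1 * p.2 * (opc 0)^[k + 2] g p.1) ?_
  -- The value of the test curve at `p.1`; for `k = 0` the convention `0 ^ 0 = 1` makes it depend on
  -- `t`.
  set W : ℝ → ℝ := fun t => (R p.1 * p.2 + t * 0 ^ k) / R p.1 with hW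
  have W0 : W 0 = p.2 := by simp [hW, R0]
  have cW : ContinuousAt W 0 := by simp only [hW]; fun_prop
  have ev : ∀ᶠ t in 𝓝 (0 : ℝ), (p.1, W t) ∈ U := by
    refine (continuousAt_const.prodMk cW : ContinuousAt (fun t => (p.1, W t)) 0) ?_
    change U ∈ 𝓝 (p.1, W 0)
    rw [W0]
    exact hP.isOpen.mem_nhds hp
  filter_upwards [ev, cW.eventually_ne (by rwa [W0])] with t ht ht2
  set y : ℝ → ℝ := (fun _ => R p.1 * p.2) + fun x => t * (x - m p.1) ^ k with hy
  have sy1 : ContDiffAt ℝ ∞ (fun x => t * (x - m p.1) ^ k) (m p.1) := by fun_prop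
  have sy : ContDiffAt ℝ ∞ y (m p.1) := contDiffAt_const.add sy1
  set w : ℝ → ℝ := (y ∘ m) / R with hw_def
  have hw : ContDiffAt ℝ ∞ w p.1 := (sy.comp p.1 sm).div sR R0
  have ew : w p.1 = W t := by simp [hw_def, hy, hW]
  have hwU : (p.1, w p.1) ∈ U := by rwa [ew]
  have hcU := curve_eventually_mem hP.isOpen hwU hw.continuousAt
  have hRw : y ∘ m =ᶠ[𝓝 p.1] R * w := by
    filter_upwards [sR.continuousAt.eventually_ne R0] with x hx
    simp only [hw_def, Pi.mul_apply, Pi.div_apply]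
    field_simp
  have hc : CurveMapsTo ρ ψ w y p.1 := curveMapsTo_of_affine hP hm hψ hwU hw sy (by
    filter_upwards [hRw, hcU] with x h1 h2
    rw [h1, Pi.add_apply, hS0 _ h2, add_zero])
  have e1 : Omega (fun _ => 0) (k + 2) y (ρ (p.1, w p.1)) = 0 := by
    rw [(hm _ hwU).1, Omega_eq_iterate]
    change (opc 0)^[k + 2] y (m p.1) = 0
    rw [(iterate_opc_add (q := 0) contDiffAt_const (k + 2) contDiffAt_const sy1).eq_of_nhds,
      Pi.add_apply, Function.iterate_succ_apply' _ (k + 1) (fun x => t * (x - m p.1) ^ k),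
      iterate_opc_zero_pow]
    have e2 := iterate_opc_zero_pow (R p.1 * p.2) 0 0
    simp only [pow_zero, mul_one, zero_add] at e2
    have e3 : ∀ n, (opc 0)^[n] (0 : ℝ → ℝ) = 0 := fun n => by
      induction n with
      | zero => rfl
      | succ n ih => rw [Function.iterate_succ_apply', ih]; funext x; simp [opc]
    rw [Function.iterate_add_apply _ (k + 1) 1, e2, e3]
    simp [opc]
  have e2 := (hT w y p.1 hc ⟨hwU, by rwa [ew]⟩).1 e1
  have hq : (fun x => Q (x, w x)) =ᶠ[𝓝 p.1] constParam k 0 m R := by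
    filter_upwards [hcU, hw.continuousAt.eventually_ne (by rwa [ew])] with x h1 h2
    exact hQq _ h1 h2
  rw [Omega_eq_iterate, (iterate_opc_congr hq (k + 2) (EventuallyEq.refl _ _)).eq_of_nhds] at e2
  have sθ : ContDiffAt ℝ ∞ (R * g) p.1 := sR.mul sg
  have conj := (mul_iterate_opc (θ := R * g) (q := constParam k 0 m R) (G := 0) sθ
    (smoothAt_constParam 0 sm sR dm0 R0) (by
      filter_upwards [deriv_mul_eventuallyEq sR sg, deriv_derivPow sm dm0 (-(k + 1) / 2),
        sR.continuousAt.eventually_ne R0] with x h1 h2 h3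
      rw [Pi.add_apply, h1]
      simp only [Pi.add_apply, Pi.mul_apply, hg, h2, constParam, Pi.smul_apply, Pi.div_apply,
        Pi.zero_apply, smul_eq_mul]
      generalize deriv (deriv m) x / deriv m x = l
      field_simp
      ring) (k + 2) hw).eq_of_nhds
  rw [Pi.mul_apply, e2, mul_zero] at conj
  have e3 : R * g * w =ᶠ[𝓝 p.1] (R p.1 * p.2) • g + t • (g * u ^ k) := by
    filter_upwards [hRw] with x hx
    have e : R x * w x = R p.1 * p.2 + t * u x ^ k := hx.symm
    simp only [Pi.mul_apply, Pi.add_apply, Pi.smul_apply, smul_eq_mul, Pi.pow_apply]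
    linear_combination g x * e
  rw [(iterate_opc_congr EventuallyEq.rfl (k + 2) e3).eq_of_nhds,
    (iterate_opc_add (q := 0) (f := (R p.1 * p.2) • g) (g := t • (g * u ^ k)) contDiffAt_const (k + 2)
      (sg.const_smul (R p.1 * p.2)) ((sg.mul (su.pow k)).const_smul t)).eq_of_nhds,
    iterate_opc_smul, iterate_opc_smul] at conj
  exact conj.symm

theorem IsEquivTransf.exists_hasMobiusForm (h : IsEquivTransf (k + 2) U ρ ψ)
    (hU : IsConnected U) (hc : ∀ z : ℝ, IsPreconnected {w : ℝ | (z, w) ∈ U}) :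
    ∃ (k₁ k₂ k₃ k₄ : ℝ) (R : ℝ → ℝ), HasMobiusForm U ρ ψ k₁ k₂ k₃ k₄ R := by
  have hP := h.1
  obtain ⟨m, hm⟩ := exists_eq_comp_fst hP.isOpen hc (fun p hp => hP.smoothAt_fst hp)
    fun p hp => h.pdw_fst_eq_zero hp
  obtain ⟨R, S, hψ⟩ := h.exists_affine hc hm
  obtain ⟨k₁, k₂, k₃, k₄, h1, h2, h3, h4⟩ := exists_mobius (m := m) (I := Prod.fst '' U)
    (isOpenMap_fst U hP.isOpen) (hU.isPreconnected.image _ continuous_fst.continuousOn)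
    (hU.nonempty.image _) (by rintro _ ⟨p, hp, rfl⟩; exact (hm p hp).2)
    (by rintro _ ⟨p, hp, rfl⟩; exact (hP.deriv_ne_zero_of_eq_comp_fst hm hp).2.2.1)
    (by rintro _ ⟨p, hp, rfl⟩; exact h.schwarzian_fst_eq_zero hm hψ hp)
  refine ⟨k₁, k₂, k₃, k₄, R, h1, h2, fun p hp => h3 _ ⟨p, hp, rfl⟩, ?_,
    fun p hp => (hψ p hp).2.2.2, fun p hp => ?_, fun p hp => ?_⟩
  · rintro _ ⟨p, hp, rfl⟩
    exact (hψ p hp).2.1.contDiffWithinAt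
  · rw [(hm p hp).1, h4 _ ⟨p, hp, rfl⟩]
  · rw [(hψ p hp).1, h.remainder_eq_zero hm hψ hp, add_zero]

end Main

end RiccatiAbel

end

theorem theorem2 :
    -- order one
    (∀ (U : Set (ℝ × ℝ)) (ρ ψ : ℝ × ℝ → ℝ), IsPointTransf U ρ ψ →
      IsEquivTransf 1 U ρ ψ ∧
      ∀ F : ℝ × ℝ → ℝ, ContDiffOn ℝ ∞ F (imageOf U ρ ψ) →
        (∀ p ∈ U, IsRegularFor 1 ρ ψ F p ↔ den ρ ψ F p ≠ 0) ∧
        ContDiffOn ℝ ∞ (Q₁ ρ ψ F) {p | p ∈ U ∧ p.2 ≠ 0 ∧ den ρ ψ F p ≠ 0} ∧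
        TransformsEq 1 ρ ψ F (Q₁ ρ ψ F) {p | p ∈ U ∧ p.2 ≠ 0 ∧ den ρ ψ F p ≠ 0}) ∧
    -- order at least two
    (∀ (n : ℕ), 2 ≤ n → ∀ (U : Set (ℝ × ℝ)), IsOpen U → IsConnected U →
      (∀ z : ℝ, IsPreconnected {w : ℝ | (z, w) ∈ U}) →
      ∀ (ρ ψ : ℝ × ℝ → ℝ),
        (IsEquivTransf n U ρ ψ ↔
          ∃ (k₁ k₂ k₃ k₄ : ℝ) (R : ℝ → ℝ), HasMobiusForm U ρ ψ k₁ k₂ k₃ k₄ R) ∧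
        ∀ (k₁ k₂ k₃ k₄ : ℝ) (R : ℝ → ℝ), HasMobiusForm U ρ ψ k₁ k₂ k₃ k₄ R →
          ∀ F : ℝ × ℝ → ℝ, ContDiffOn ℝ ∞ F (imageOf U ρ ψ) →
            ContDiffOn ℝ ∞ (Qₙ n F (mobius k₁ k₂ k₃ k₄) R) U ∧
            TransformsEq n ρ ψ F (Qₙ n F (mobius k₁ k₂ k₃ k₄) R) U) := by
  refine ⟨fun U ρ ψ h => ⟨h.isEquivTransf_one, fun F hF => ⟨fun p hp =>
    h.isRegularFor_one_iff hp, h.contDiffOn_Q₁ hF, h.transformsEq_one F⟩⟩, ?_⟩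
  intro n hn U hU hUc hs ρ ψ
  obtain ⟨k, rfl⟩ : ∃ k, n = k + 2 := ⟨n - 2, by omega⟩
  refine ⟨⟨fun h => h.exists_hasMobiusForm hUc hs, ?_⟩, ?_⟩
  · rintro ⟨k₁, k₂, k₃, k₄, R, h⟩
    exact h.isEquivTransf hU (k + 1)
  · intro k₁ k₂ k₃ k₄ R h F hF
    exact ⟨h.contDiffOn_Qₙ hU (k + 2) hF, h.transformsEq hU (k + 1) hF⟩
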